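/- Let $K$ be a field and let $\Delta$ be a simplicial complex on a finite nonempty vertex set $\{x_1,\dots,x_n\}$ (every $\{x_i\}$ is a face). A facet is a maximal face, and $\dim F=|F|-1$. A chain between facets $F$ and $G$ is a sequence of facets $F=F_0,\dots,F_r=G$ with $F_i\cap F_{i+1}\neq\emptyset$ for all $0\le i<r$; the complex $\Delta$ is connected if any two facets are joined by a chain. It is connected in codimension $1$ if for any two facets $F,G$ with $\dim F\ge\dim G$ there is a chain $F=F_0,\dots,F_r=G$ with $\dim(F_i\cap F_{i+1})=\dim F_{i+1}-1$ for all $0\le i<r$. A facet $F$ of a complex is a leaf if it is the only facet, or if there is a facet $G\ne F$ such that $F\cap H\subseteq F\cap G$ for every facet $H\neq F$. A subcomplex of $\Delta$ is a complex all of whose facets are facets of $\Delta$. The complex $\Delta$ is a tree if it is connected and every nonempty subcomplex of $\Delta$ has a leaf. Let $R=K[x_1,\dots,x_n]$ with the standard grading, and let $I\subset R$ be the facet ideal of $\Delta$, generated by the monomials $\prod_{x\in F}x$ with $F$ a facet of $\Delta$. Let $d$ be the least degree of a minimal monomial generator of $I$. Let $b_{i,k}=b_{i,k}(R/I)$ be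 the graded Betti numbers of $R/I$, that is, the number of summands $R(-k)$ in homological degree $i$ of a minimal graded free resolution of $R/I$ (such a resolution exists, and any of them may be used). Theorem 4.6. Suppose that $\Delta$ is a tree, not necessarily pure, that is connected in codimension $1$. Then $I$ has the alternating sum property: for each integer $j\ge d-1$ only finitely many $b_{i,i+j}$ are nonzero, and $$\sum_{i\ge 1}(-1)^i\,b_{i,i+j}(R/I)=\begin{cases}-1,& j=d-1,\\ 0,& j>d-1.\end{cases}$$ -/

import Mathlib

open MvPolynomial

namespace FacetIdeal

/-! ### Simplicial complexes, facets, leaves and trees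

Mathlib's simplicial complexes do not count the empty set as a face. This changes neither the facets
nor the subcomplexes of a complex that has a vertex. -/

section Complexes

variable {V : Type*}

/-- `F` is a facet of `Γ`: a face that is maximal under inclusion. -/
def IsFacet (Γ : PreAbstractSimplicialComplex V) (F : Finset V) : Prop :=
  Maximal (fun G : Finset V => G ∈ Γ.faces) F

/-- The facet set of `Γ`. -/
def facets (Γ : PreAbstractSimplicialComplex V) : Set (Finset V) :=
  {F | IsFacet Γ F}

/-- The dimension of a face is its number of vertices minus one, so that the empty set has
dimension `-1`. -/
def faceDim (F : Finset V) : ℤ :=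
  (F.card : ℤ) - 1

/-- `Γ` is a subcomplex of `Δ` if each facet of `Γ` is a facet of `Δ`. -/
def IsSubcomplex (Γ Δ : PreAbstractSimplicialComplex V) : Prop :=
  facets Γ ⊆ facets Δ

variable [DecidableEq V]

/-- `c 0, …, c n` is a chain of `Γ` between the facets `F` and `G`: it consists of facets, and
consecutive ones intersect. -/
def IsFacetChain (Γ : PreAbstractSimplicialComplex V) (F G : Finset V) (n : ℕ)
    (c : ℕ → Finset V) : Prop :=
  c 0 = F ∧ c n = G ∧ (∀ i ≤ n, IsFacet Γ (c i)) ∧ ∀ i < n, (c i ∩ c (i + 1)).Nonempty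

/-- A proper chain: a chain such that `dim (c i ∩ c (i + 1)) = dim (c (i + 1)) - 1`. -/
def IsProperChain (Γ : PreAbstractSimplicialComplex V) (F G : Finset V) (n : ℕ)
    (c : ℕ → Finset V) : Prop :=
  IsFacetChain Γ F G n c ∧ ∀ i < n, faceDim (c i ∩ c (i + 1)) = faceDim (c (i + 1)) - 1

/-- Any two facets are joined by a chain. -/
def IsConnected (Γ : PreAbstractSimplicialComplex V) : Prop :=
  ∀ F G, IsFacet Γ F → IsFacet Γ G → ∃ n c, IsFacetChain Γ F G n c

/-- For any two facets `F`, `G` with `dim F ≥ dim G` there is a proper chain from `F` to `G`. -/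
def IsConnectedInCodimOne (Γ : PreAbstractSimplicialComplex V) : Prop :=
  ∀ F G, IsFacet Γ F → IsFacet Γ G → faceDim G ≤ faceDim F → ∃ n c, IsProperChain Γ F G n c

/-- A facet `F` is a leaf if it is the only facet, or there is a facet `G ≠ F` such that
`F ∩ H ⊆ F ∩ G` for every facet `H ≠ F`. -/
def IsLeaf (Γ : PreAbstractSimplicialComplex V) (F : Finset V) : Prop :=
  IsFacet Γ F ∧
    ((∀ H, IsFacet Γ H → H = F) ∨
      ∃ G, IsFacet Γ G ∧ G ≠ F ∧ ∀ H, IsFacet Γ H → H ≠ F → F ∩ H ⊆ F ∩ G)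

/-- A tree (in the sense of Faridi): a connected complex all of whose nonempty subcomplexes have a
leaf. -/
def IsTree (Δ : PreAbstractSimplicialComplex V) : Prop :=
  IsConnected Δ ∧
    ∀ Γ : PreAbstractSimplicialComplex V, IsSubcomplex Γ Δ → Γ.faces.Nonempty → ∃ F, IsLeaf Γ F

end Complexes

/-! ### Facet ideals and graded Betti numbers -/

section Ideals

variable {V : Type*} {K : Type*} [Field K]

/-- The facet ideal: generated by the squarefree monomials `∏_{v ∈ F} x_v`, `F` a facet. -/
noncomputable def facetIdeal (K : Type*) [Field K] (Γ : PreAbstractSimplicialComplex V) :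
    Ideal (MvPolynomial V K) :=
  Ideal.span {f | ∃ F, IsFacet Γ F ∧ f = ∏ v ∈ F, X v}

/-- `f` lies in the component of degree `k ∈ ℤ` of the standard graded polynomial ring; the
components of negative degree are zero. -/
def HasIntDegree (f : MvPolynomial V K) (k : ℤ) : Prop :=
  ∀ m ∈ f.support, ((Finsupp.degree m : ℕ) : ℤ) = k

/-- A minimal graded free resolution
`⋯ → ⨁ₐ R(-shift 1 a) → ⨁ₐ R(-shift 0 a) → R ⧸ I → 0` of `R ⧸ I`, `R` a standard graded polynomial
ring. The `a`-th basis vector of the `i`-th free module has degree `shift i a`, all maps preserve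
degrees, and the differentials have their image in `𝔪` times the free module, `𝔪` the ideal
generated by the variables. -/
structure MinimalGradedFreeResolution (I : Ideal (MvPolynomial V K)) where
  rank : ℕ → ℕ
  shift : ∀ i, Fin (rank i) → ℤ
  diff : ∀ i, (Fin (rank (i + 1)) → MvPolynomial V K) →ₗ[MvPolynomial V K]
    (Fin (rank i) → MvPolynomial V K)
  aug : (Fin (rank 0) → MvPolynomial V K) →ₗ[MvPolynomial V K] (MvPolynomial V K ⧸ I)
  diff_graded : ∀ i (b : Fin (rank (i + 1))) (a : Fin (rank i)),
    HasIntDegree (diff i (Pi.single b 1) a) (shift (i + 1) b - shift i a)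
  aug_graded : ∀ a : Fin (rank 0), ∃ f : MvPolynomial V K,
    HasIntDegree f (shift 0 a) ∧ aug (Pi.single a 1) = Ideal.Quotient.mk I f
  minimal : ∀ i (b : Fin (rank (i + 1))) (a : Fin (rank i)),
    diff i (Pi.single b 1) a ∈ Ideal.span (Set.range (X : V → MvPolynomial V K))
  aug_surjective : Function.Surjective aug
  exact_zero : Function.Exact (diff 0) aug
  exact_succ : ∀ i, Function.Exact (diff (i + 1)) (diff i)

/-- The number `b_{i,k}` of summands `R(-k)` in the `i`-th free module of the resolution, that is,
the graded Betti number `b_{i,k}(R ⧸ I)`. -/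
noncomputable def MinimalGradedFreeResolution.betti {I : Ideal (MvPolynomial V K)}
    (P : MinimalGradedFreeResolution I) (i : ℕ) (k : ℤ) : ℕ :=
  Nat.card {a : Fin (P.rank i) // P.shift i a = k}

/-- The exponents of the minimal monomial generators `G(I)` of a monomial ideal `I`: the monomials
in `I` that are minimal under divisibility. -/
def minimalMonomials (I : Ideal (MvPolynomial V K)) : Set (V →₀ ℕ) :=
  {m | Minimal (fun n : V →₀ ℕ => monomial n (1 : K) ∈ I) m}

/-- The alternating sum property of a monomial ideal `I`: if `d` is the least degree of a minimal
monomial generator, then `∑_{i ≥ 1} (-1)^i b_{i,i+j}(R ⧸ I)` is `-1` for `j = d - 1`, the lowest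
linear strand, and `0` for `j > d - 1`. It includes that minimal graded free resolutions exist and
that the sums are finite; the Betti numbers may be read off from any of these resolutions. -/
def AlternatingSumProperty (I : Ideal (MvPolynomial V K)) : Prop :=
  Nonempty (MinimalGradedFreeResolution I) ∧
    ∃ d : ℕ, IsLeast (Finsupp.degree '' minimalMonomials I) d ∧
      ∀ (P : MinimalGradedFreeResolution I) (j : ℤ), (d : ℤ) - 1 ≤ j →
        {i : ℕ | P.betti i (i + j) ≠ 0}.Finite ∧
          ∑ᶠ (i : ℕ) (_ : 1 ≤ i), (-1 : ℤ) ^ i * (P.betti i (i + j) : ℤ) =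
            if j = (d : ℤ) - 1 then -1 else 0

end Ideals

end FacetIdeal

/-! Facets are removed one at a time. Fix a facet `F₀` of least cardinality; as long as there are
two facets, a forest has a leaf `F ≠ F₀`. A leaf has a free vertex, lying in no other facet. If `I'`
is the ideal of the remaining facets and `x_F` the monomial of `F`, the sequence `0 → R/(I' :
x_F)(-|F|) → R/I' → R/I → 0` is exact, and the mapping cone of the induced map of resolutions is
again minimal: the free vertex divides `x_F` but no multidegree occurring in the resolution of
`R/I'`, so no entry of the comparison map is a unit (`SquarefreeResolution.exists_cone`). Hence the
alternating sums of `I` are those of `I'` minus shifted ones of the colon ideal.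

Since `|F₀| ≤ |F|`, a proper chain leads from `F` to `F₀`. Its first step is a facet `G` with `|G \
F| = 1`, so the colon ideal contains a variable. That variable and an ideal not involving it
generate the colon ideal; the cone over multiplication by the variable contributes each basis vector
twice, with opposite signs in the same strand, so all alternating sums of the colon ideal vanish
(`IsForest.exists_colon_resolution`). Removing a leaf preserves connectedness by proper steps
(`IsLeafOf.reflTransGen_erase`), so induction reduces to the single facet `F₀`.

Everything is squarefree, so the resolutions are built as scalar matrices with a set of vertices as
multidegree, and turned into resolutions over the polynomial ring only at the end. Uniqueness of
graded Betti numbers (`MinimalGradedFreeResolution.betti_eq`) transfers the result to every minimal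
graded free resolution. -/

namespace FacetIdeal

open Matrix

/-! ### Squarefree multigraded resolutions, comparison maps and mapping cones -/

section SquarefreeResolutions

/-- A finite minimal multigraded free resolution of `R ⧸ I`, `I` a squarefree monomial ideal,
written with scalars. `J W` says that the product of the variables in `W` lies in `I`, the basis
vector `a` has homological degree `idx a` and multidegree `deg a ⊆ U`, and the differential sends
the basis vector `b` to `∑ a, D a b x ^ (deg b \ deg a) a`. -/
structure SquarefreeResolution {V : Type*} (K : Type*) [Field K] (J : Finset V → Prop)
    (U : Finset V) where
  ι : Type
  [fintype : Fintype ι]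
  [decEq : DecidableEq ι]
  idx : ι → ℕ
  deg : ι → Finset V
  base : ι
  D : Matrix ι ι K
  deg_base : deg base = ∅
  idx_eq_zero : ∀ a, idx a = 0 ↔ a = base
  deg_subset : ∀ a, deg a ⊆ U
  idx_of_ne : ∀ a b, D a b ≠ 0 → idx b = idx a + 1
  deg_of_ne : ∀ a b, D a b ≠ 0 → deg a ⊂ deg b
  mem_of_ne : ∀ b, D base b ≠ 0 → J (deg b)
  sq_zero : D * D = 0
  exact : ∀ (W : Finset V) (k : ℕ) (z : ι → K), (∀ a, z a ≠ 0 → idx a = k ∧ deg a ⊆ W) →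
    D *ᵥ z = 0 → (k = 0 → J W) →
      ∃ y : ι → K, (∀ a, y a ≠ 0 → idx a = k + 1 ∧ deg a ⊆ W) ∧ D *ᵥ y = z

attribute [instance] SquarefreeResolution.fintype SquarefreeResolution.decEq

namespace SquarefreeResolution

variable {V : Type*} {K : Type*} [Field K] {J J' : Finset V → Prop} {U U' : Finset V}

/-- The alternating sum `∑ i, (-1) ^ i b_{i,i+j}`. -/
def altSum (M : SquarefreeResolution K J U) (j : ℤ) : ℤ :=
  ∑ a, if ((M.deg a).card : ℤ) = M.idx a + j then (-1) ^ M.idx a else 0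

/-- The resolution of `R` itself. -/
def trivial (K : Type*) [Field K] : SquarefreeResolution K (fun _ : Finset V => False) ∅ where
  ι := Unit
  idx _ := 0
  deg _ := ∅
  base := ()
  D := 0
  deg_base := rfl
  idx_eq_zero := by simp
  deg_subset := by simp
  idx_of_ne := by simp
  deg_of_ne := by simp
  mem_of_ne := by simp
  sq_zero := by simp
  exact := by
    intro W k z hz _ hk
    refine ⟨0, by simp, ?_⟩
    rw [mulVec_zero]
    funext a
    by_contra h
    exact hk (hz a (Ne.symm h)).1.symm

theorem altSum_trivial (j : ℤ) :
    (trivial K : SquarefreeResolution K (fun _ : Finset V => False) ∅).altSum j =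
      if j = 0 then 1 else 0 := by
  have : (trivial K : SquarefreeResolution K (fun _ : Finset V => False) ∅).altSum j =
    ∑ a : Unit, if (((∅ : Finset V).card : ℤ) = (0 : ℕ) + j) then (-1) ^ 0 else 0 := rfl
  simp [this, eq_comm]

/-- Replace the ideal by an equal one, and enlarge the support. -/
def cast (M : SquarefreeResolution K J U) (hJ : ∀ W, J W ↔ J' W) (hU : U ⊆ U') :
    SquarefreeResolution K J' U' :=
  { M with
    deg_subset := fun a => (M.deg_subset a).trans hU
    mem_of_ne := fun b hb => (hJ _).1 (M.mem_of_ne b hb)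
    exact := fun W k z h1 h2 h3 => M.exact W k z h1 h2 fun hk => (hJ _).2 (h3 hk) }

theorem altSum_cast (M : SquarefreeResolution K J U) (hJ : ∀ W, J W ↔ J' W) (hU : U ⊆ U')
    (j : ℤ) : (M.cast hJ hU).altSum j = M.altSum j := rfl

theorem D_base_right (M : SquarefreeResolution K J U) (a : M.ι) : M.D a M.base = 0 := by
  by_contra h
  have := M.idx_of_ne _ _ h
  rw [(M.idx_eq_zero M.base).2 rfl] at this
  omega

theorem exists_ne_of_mulVec_ne {R m n : Type*} [CommRing R] [Fintype n] {A : Matrix m n R}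
    {z : n → R} {a : m}
    (h : (A *ᵥ z) a ≠ 0) : ∃ b, A a b ≠ 0 ∧ z b ≠ 0 := by
  obtain ⟨b, -, hb⟩ := Finset.exists_ne_zero_of_sum_ne_zero (by simpa [mulVec, dotProduct] using h)
  exact ⟨b, left_ne_zero_of_mul hb, right_ne_zero_of_mul hb⟩

variable [DecidableEq V]

/-- The comparison theorem, one homological degree at a time: `φ` commutes with the differentials
only on basis vectors of degree at most `k`. The scalar `φ a b` stands for a multiple of the
monomial of `(F ∪ deg b) \ deg a`, and the entry `1` at the base vectors says that `1` is sent to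
the product of the variables in `F`. -/
theorem exists_comparison_le (M : SquarefreeResolution K J U) (N : SquarefreeResolution K J' U')
    (F : Finset V) (h : ∀ W, J' W → J (F ∪ W)) (k : ℕ) :
    ∃ φ : Matrix M.ι N.ι K,
      (∀ a b, φ a b ≠ 0 → M.idx a = N.idx b ∧ M.deg a ⊆ F ∪ N.deg b) ∧
      (∀ b, N.idx b ≤ k → M.D *ᵥ φ.col b = φ *ᵥ N.D.col b) ∧ φ M.base N.base = 1 := by
  induction k with
  | zero =>
    refine ⟨Matrix.single M.base N.base 1, ?_, ?_, by simp⟩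
    · intro a b hab
      obtain ⟨rfl, rfl⟩ : M.base = a ∧ N.base = b := by
        by_contra hc
        exact hab (Matrix.single_apply_of_ne _ _ _ _ _ hc)
      simp [(M.idx_eq_zero _).2, (N.idx_eq_zero _).2, M.deg_base]
    · intro b hb
      obtain rfl := (N.idx_eq_zero b).1 (by omega)
      have h1 : N.D.col N.base = 0 := funext fun a => N.D_base_right a
      rw [h1, mulVec_zero]
      funext a
      by_contra hc
      obtain ⟨c, hc1, hc2⟩ := exists_ne_of_mulVec_ne hc
      rw [col_apply] at hc2
      obtain rfl : M.base = c := by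
        by_contra hc3
        exact hc2 (Matrix.single_apply_of_ne _ _ _ _ _ fun h => hc3 h.1)
      exact hc1 (M.D_base_right a)
  | succ k ih =>
    obtain ⟨φ, h1, h2, h3⟩ := ih
    have key : ∀ b, N.idx b = k + 1 → ∃ y : M.ι → K,
        (∀ a, y a ≠ 0 → M.idx a = k + 1 ∧ M.deg a ⊆ F ∪ N.deg b) ∧
          M.D *ᵥ y = φ *ᵥ N.D.col b := by
      intro b hb
      by_cases hz : φ *ᵥ N.D.col b = 0
      · exact ⟨0, by simp, by rw [hz, mulVec_zero]⟩
      have hcol : ∀ c, N.D.col b c ≠ 0 → N.idx c = k := fun c hc => by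
        have := N.idx_of_ne c b hc
        omega
      refine M.exact _ k _ ?_ ?_ ?_
      · intro a ha
        obtain ⟨c, hc1, hc2⟩ := exists_ne_of_mulVec_ne ha
        have := h1 a c hc1
        exact ⟨this.1.trans (hcol c hc2),
          this.2.trans (Finset.union_subset_union_right (N.deg_of_ne c b hc2).1)⟩
      · have e1 : M.D *ᵥ (φ *ᵥ N.D.col b) = φ *ᵥ (N.D *ᵥ N.D.col b) := by
          rw [mulVec_mulVec, mulVec_mulVec, mulVec_eq_sum, mulVec_eq_sum]
          refine Finset.sum_congr rfl fun c _ => ?_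
          by_cases hc : N.D.col b c = 0
          · rw [hc, MulOpposite.op_zero, zero_smul, zero_smul]
          · congr 1
            exact h2 c (hcol c hc).le
        have e2 : N.D *ᵥ N.D.col b = 0 := by
          funext a
          exact congrFun (congrFun N.sq_zero a) b
        rw [e1, e2, mulVec_zero]
      -- In degree zero the boundary of `b` lies in `J'`, so its product with the monomial of `F`
      -- lies in `J` and is a boundary in `M`.
      · rintro rfl
        obtain ⟨a, ha⟩ := Function.ne_iff.1 hz
        obtain ⟨c, hc1, hc2⟩ := exists_ne_of_mulVec_ne ha
        obtain rfl := (N.idx_eq_zero c).1 (hcol c hc2)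
        exact h _ (N.mem_of_ne b hc2)
    choose! y hy1 hy2 using key
    -- Only columns of index `k + 1` get replaced, and boundaries of basis vectors of index at most
    -- `k + 1` do not meet them.
    have hφ : ∀ b, N.idx b ≤ k + 1 → ∀ c, N.D.col b c ≠ 0 → N.idx c ≠ k + 1 := by
      intro b hb c hc
      have := N.idx_of_ne c b hc
      omega
    refine ⟨Matrix.of fun a b => if N.idx b = k + 1 then y b a else φ a b, ?_, ?_, ?_⟩
    · intro a b hab
      simp only [Matrix.of_apply] at hab
      split_ifs at hab with hb
      · rw [hb]
        exact hy1 b hb a hab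
      · exact h1 a b hab
    · intro b hb
      have e : (Matrix.of fun a b => if N.idx b = k + 1 then y b a else φ a b) *ᵥ N.D.col b = φ *ᵥ N.D.col b := by
        funext a
        refine Finset.sum_congr rfl fun c _ => ?_
        by_cases hc : N.D.col b c = 0
        · rw [hc, mul_zero, mul_zero]
        · simp [hφ b hb c hc]
      rw [e]
      by_cases hb' : N.idx b = k + 1
      · rw [← hy2 b hb']
        congr 1
        funext a
        simp only [col_apply, Matrix.of_apply, hb', if_true]
      · rw [← h2 b (by omega)]
        congr 1
        funext a
        simp only [col_apply, Matrix.of_apply, hb', if_false]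
    · simp [(N.idx_eq_zero N.base).2, h3]

/-- Multiplication by the product of the variables in `F` lifts to a map of resolutions. -/
theorem exists_comparison (M : SquarefreeResolution K J U) (N : SquarefreeResolution K J' U')
    (F : Finset V) (h : ∀ W, J' W → J (F ∪ W)) :
    ∃ φ : Matrix M.ι N.ι K,
      (∀ a b, φ a b ≠ 0 → M.idx a = N.idx b ∧ M.deg a ⊆ F ∪ N.deg b) ∧
      M.D * φ = φ * N.D ∧ φ M.base N.base = 1 := by
  obtain ⟨φ, h1, h2, h3⟩ := exists_comparison_le M N F h (Finset.univ.sup N.idx)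
  refine ⟨φ, h1, ?_, h3⟩
  ext a b
  exact congrFun (h2 b (Finset.le_sup (Finset.mem_univ b))) a

/-- If some vertex of `F` is not in the support `U` of `J`, and `J'` is the colon ideal of `J` by
`F`, then the mapping cone is a minimal resolution for `J + (F)`. -/
theorem exists_cone (M : SquarefreeResolution K J U) (N : SquarefreeResolution K J' U')
    (F : Finset V) (hmono : ∀ s t, s ⊆ t → J s → J t) (hJ : ∀ W, J' W ↔ J (F ∪ W)) (v : V)
    (hvF : v ∈ F) (hvU : v ∉ U) (hF : Disjoint F U') :
    ∃ C : SquarefreeResolution K (fun W => J W ∨ F ⊆ W) (U ∪ (F ∪ U')),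
      ∀ j, C.altSum j = M.altSum j - N.altSum (j - F.card + 1) := by
  obtain ⟨φ, h1, h2, h3⟩ := exists_comparison M N F fun W => (hJ W).1
  have hJ' : ∀ W, F ⊆ W → (J' W ↔ J W) := fun W hW => by
    rw [hJ, Finset.union_eq_right.2 hW]
  have hdisj : ∀ b, Disjoint F (N.deg b) := fun b => hF.mono_right (N.deg_subset b)
  -- Minimality of the cone: `v` lies in `F` but in no multidegree of `M`, so the comparison map has
  -- no unit entries.
  have hssub : ∀ a b, M.deg a ⊆ F ∪ N.deg b → M.deg a ⊂ F ∪ N.deg b := fun a b hab =>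
    Finset.ssubset_iff_subset_ne.2 ⟨hab, fun h => hvU (M.deg_subset a (by
      rw [h]
      exact Finset.mem_union_left _ hvF))⟩
  have colbase : M.D *ᵥ (φ.col N.base) = 0 := by
    funext a
    have := congrFun (congrFun h2 a) N.base
    rw [mul_apply] at this
    refine this.trans ?_
    rw [mul_apply]
    exact Finset.sum_eq_zero fun c _ => by rw [N.D_base_right, mul_zero]
  have hcolbase : ∀ a, φ a N.base ≠ 0 → a = M.base := fun a ha =>
    (M.idx_eq_zero a).1 ((h1 a _ ha).1.trans ((N.idx_eq_zero _).2 rfl))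
  have mul0 : ∀ (x : M.ι → K) (y : N.ι → K),
      fromBlocks M.D φ 0 (-N.D) *ᵥ (Sum.elim x y) =
        Sum.elim (M.D *ᵥ x + φ *ᵥ y) (-(N.D *ᵥ y)) := fun x y => by
    rw [fromBlocks_mulVec, Sum.elim_comp_inl, Sum.elim_comp_inr, zero_mulVec, zero_add, neg_mulVec]
  refine ⟨{
    ι := M.ι ⊕ N.ι
    idx := Sum.elim M.idx fun b => N.idx b + 1
    deg := Sum.elim M.deg fun b => F ∪ N.deg b
    base := Sum.inl M.base
    D := fromBlocks M.D φ 0 (-N.D)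
    deg_base := M.deg_base
    idx_eq_zero := ?_
    deg_subset := ?_
    idx_of_ne := ?_
    deg_of_ne := ?_
    mem_of_ne := ?_
    sq_zero := ?_
    exact := ?_ }, ?_⟩
  · rintro (a | b)
    · simp [M.idx_eq_zero]
    · simp
  · rintro (a | b)
    · exact (M.deg_subset a).trans Finset.subset_union_left
    · exact (Finset.union_subset_union_right (N.deg_subset b)).trans Finset.subset_union_right
  · rintro (a | a) (b | b) hab
    · exact M.idx_of_ne a b hab
    · simpa using (h1 a b hab).1.symm
    · exact absurd rfl hab
    · simpa using N.idx_of_ne a b (by simpa using hab)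
  · rintro (a | a) (b | b) hab
    · exact M.deg_of_ne a b hab
    · exact hssub a b (h1 a b hab).2
    · exact absurd rfl hab
    · have := N.deg_of_ne a b (by simpa using hab)
      obtain ⟨x, hx, hx'⟩ := Finset.exists_of_ssubset this
      refine Finset.ssubset_iff_subset_ne.2 ⟨Finset.union_subset_union_right this.1, fun h => ?_⟩
      have hxF := Finset.disjoint_right.1 (hdisj b) hx
      have : x ∈ F ∪ N.deg a := by
        simp only [Sum.elim_inr] at h
        rw [h]
        exact Finset.mem_union_right _ hx
      exact (Finset.mem_union.1 this).elim hxF hx'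
  · rintro (b | b) hab
    · exact Or.inl (M.mem_of_ne b hab)
    · exact Or.inr Finset.subset_union_left
  · rw [fromBlocks_multiply]
    simp only [M.sq_zero, N.sq_zero, Matrix.mul_zero, Matrix.zero_mul, add_zero,
      Matrix.neg_mul, Matrix.mul_neg, neg_zero, h2]
    rw [add_neg_cancel, fromBlocks_zero]
  · intro W k z hz hDz hk
    obtain ⟨x, y, rfl⟩ : ∃ x y, z = Sum.elim x y :=
      ⟨z ∘ Sum.inl, z ∘ Sum.inr, (Sum.elim_comp_inl_inr z).symm⟩
    have hx : ∀ a, x a ≠ 0 → M.idx a = k ∧ M.deg a ⊆ W := fun a => hz (Sum.inl a)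
    have hy : ∀ b, y b ≠ 0 → N.idx b + 1 = k ∧ F ∪ N.deg b ⊆ W := fun b => hz (Sum.inr b)
    rw [mul0] at hDz
    have hDx : M.D *ᵥ x + φ *ᵥ y = 0 := funext fun a => congrFun hDz (Sum.inl a)
    have hDy : N.D *ᵥ y = 0 := funext fun b => neg_eq_zero.1 (congrFun hDz (Sum.inr b))
    have hM : y = 0 → (k = 0 → J W) → ∃ y' : M.ι ⊕ N.ι → K,
        (∀ a, y' a ≠ 0 → Sum.elim M.idx (fun b => N.idx b + 1) a = k + 1 ∧
          Sum.elim M.deg (fun b => F ∪ N.deg b) a ⊆ W) ∧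
          fromBlocks M.D φ 0 (-N.D) *ᵥ y' = Sum.elim x y := by
      rintro rfl hk
      obtain ⟨x', hx', hx''⟩ := M.exact W k x hx (by simpa using hDx) hk
      refine ⟨Sum.elim x' 0, ?_, ?_⟩
      · rintro (a | b) h
        · exact hx' a h
        · exact absurd rfl h
      · rw [mul0, hx'']
        simp
    by_cases hy0 : y = 0
    · by_cases hkJ : k = 0 → J W
      · exact hM hy0 hkJ
      · push Not at hkJ
        obtain ⟨rfl, hJW⟩ := hkJ
        have hFW := (hk rfl).resolve_left hJW
        -- Here the monomial of `W` is divisible by that of `F`: the multiple of the base vector is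
        -- the boundary of the same multiple of the new generator, as `φ M.base N.base = 1`.
        refine ⟨Sum.elim 0 (Pi.single N.base (x M.base)), ?_, ?_⟩
        · rintro (a | b) h
          · exact absurd rfl h
          · obtain rfl : b = N.base := by
              by_contra hb
              exact h (Pi.single_eq_of_ne hb _)
            simp [(N.idx_eq_zero _).2, N.deg_base, hFW]
        · rw [mul0, mulVec_single, mulVec_single, hy0]
          congr 1
          · funext a
            rw [mulVec_zero, zero_add]
            by_cases ha : a = M.base
            · subst ha
              simp [h3]
            · have e1 : x a = 0 := by
                by_contra h
                exact ha ((M.idx_eq_zero a).1 (hx a h).1)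
              have e2 : φ a N.base = 0 := by
                by_contra h
                exact ha (hcolbase a h)
              simp [e1, e2]
          · funext b
            simp [N.D_base_right]
    · obtain ⟨b₀, hb₀⟩ := Function.ne_iff.1 hy0
      obtain ⟨hk0, hW⟩ := hy b₀ hb₀
      have hFW : F ⊆ W := Finset.subset_union_left.trans hW
      -- If `y` sits at the base of `N`, the cycle condition reads, at `M.base`, that `M.D *ᵥ x` and
      -- `y N.base` cancel. Outside the ideal the former vanishes in multidegree `W`, which would
      -- force `y = 0`.
      have hN : N.idx b₀ = 0 → J' W := by
        intro hb0
        by_contra hJW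
        rw [hJ' W hFW] at hJW
        have hyb : ∀ b, y b ≠ 0 → b = N.base := fun b hb =>
          (N.idx_eq_zero b).1 (by have := (hy b hb).1; omega)
        obtain rfl := hyb b₀ hb₀
        have hy' : y = Pi.single N.base (y N.base) := by
          funext b
          by_cases hb : b = N.base
          · subst hb; simp
          · rw [Pi.single_eq_of_ne hb]
            by_contra h
            exact hb (hyb b h)
        have e1 : (M.D *ᵥ x) M.base = 0 := by
          by_contra hc
          obtain ⟨c, hc1, hc2⟩ := exists_ne_of_mulVec_ne hc
          exact hJW (hmono _ _ (hx c hc2).2 (M.mem_of_ne c hc1))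
        have e2 := congrFun hDx M.base
        rw [Pi.add_apply, e1, zero_add, hy', mulVec_single] at e2
        simp [h3] at e2
        exact hb₀ e2
      obtain ⟨y', hy', hy''⟩ := N.exact W (N.idx b₀) y
        (fun b hb => ⟨by have := (hy b hb).1; omega, Finset.subset_union_right.trans (hy b hb).2⟩)
        hDy hN
      obtain ⟨x', hx', hx''⟩ := M.exact W k (x + φ *ᵥ y')
        (by
          intro a ha
          by_cases hxa : x a = 0
          · rw [Pi.add_apply, hxa, zero_add] at ha
            obtain ⟨b, hb1, hb2⟩ := exists_ne_of_mulVec_ne ha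
            have := h1 a b hb1
            have h' := hy' b hb2
            exact ⟨by omega, this.2.trans (Finset.union_subset hFW h'.2)⟩
          · exact hx a hxa)
        (by
          rw [mulVec_add, mulVec_mulVec, h2, ← mulVec_mulVec, hy'', hDx])
        (by omega)
      -- `y'` bounds `y` in `N`, and `x'` bounds the corrected cycle `x + φ *ᵥ y'` in `M`; the sign
      -- compensates the block `-N.D`.
      refine ⟨Sum.elim x' (-y'), ?_, ?_⟩
      · rintro (a | b) h
        · exact hx' a h
        · have h' := hy' b (by simpa using h)
          exact ⟨by simp; omega, Finset.union_subset hFW h'.2⟩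
      · rw [mul0, mulVec_neg, mulVec_neg, neg_neg, hx'', hy'', add_neg_cancel_right]
  · intro j
    simp only [altSum]
    rw [Fintype.sum_sum_type, sub_eq_add_neg, ← Finset.sum_neg_distrib]
    congr 1
    refine Finset.sum_congr rfl fun b _ => ?_
    simp only [Sum.elim_inr, Finset.card_union_of_disjoint (hdisj b)]
    -- Basis vectors of `N` rise by one in homological degree and by `|F|` in internal degree, which
    -- moves strand `j - |F| + 1` to strand `j`.
    have : (((F.card + (N.deg b).card : ℕ) : ℤ) = ((N.idx b + 1 : ℕ) : ℤ) + j) ↔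
        (((N.deg b).card : ℕ) : ℤ) = N.idx b + (j - F.card + 1) := by
      push_cast
      omega
    simp only [this, pow_succ]
    split_ifs <;> simp

end SquarefreeResolution

end SquarefreeResolutions

/-! ### Leaves, forests and colon ideals -/

section Forests

variable {V : Type*}

/-- The squarefree monomial with support `W` lies in the ideal generated by those with support
in `S`. -/
def Generates (S : Finset (Finset V)) (W : Finset V) : Prop :=
  ∃ H ∈ S, H ⊆ W

theorem Generates.mono {S : Finset (Finset V)} {s t : Finset V} (hst : s ⊆ t)
    (h : Generates S s) : Generates S t :=
  let ⟨H, hH, hHs⟩ := h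
  ⟨H, hH, hHs.trans hst⟩

variable [DecidableEq V]

/-- `F` is a leaf of the complex with facet set `T`. -/
def IsLeafOf (T : Finset (Finset V)) (F : Finset V) : Prop :=
  F ∈ T ∧ ((∀ H ∈ T, H = F) ∨ ∃ G ∈ T, G ≠ F ∧ ∀ H ∈ T, H ≠ F → F ∩ H ⊆ F ∩ G)

/-- Every nonempty subset of `S` has a leaf. -/
def IsForest (S : Finset (Finset V)) : Prop :=
  ∀ T ⊆ S, T.Nonempty → ∃ F, IsLeafOf T F

theorem IsForest.mono {S T : Finset (Finset V)} (hS : IsForest S) (h : T ⊆ S) : IsForest T :=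
  fun T' hT' => hS T' (hT'.trans h)

/-- Leaves survive the removal of `F` from all members, since intersections only lose elements of
`F`. This makes colon ideals accessible to induction. The new family may contain comparable members,
so forests are not required to be antichains. -/
theorem IsForest.image_sdiff {S : Finset (Finset V)} (hS : IsForest S) (F : Finset V) :
    IsForest (S.image (· \ F)) := by
  intro T hT hTne
  -- Keeping one preimage per member ensures that the leaf and its partner remain distinct after
  -- removing `F`.
  obtain ⟨T', hT'S, hinj, rfl⟩ := Finset.exists_subset_injOn_image_eq_of_surjOn (f := (· \ F))
    S T (fun x hx => by simpa using hT hx)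
  obtain ⟨A, hA, hA'⟩ := hS T' (by exact_mod_cast hT'S) (Finset.image_nonempty.1 hTne)
  refine ⟨A \ F, Finset.mem_image_of_mem _ hA, ?_⟩
  rcases hA' with h | ⟨G, hG, hGA, h⟩
  · left
    intro H hH
    obtain ⟨H', hH', rfl⟩ := Finset.mem_image.1 hH
    rw [h H' hH']
  · right
    refine ⟨G \ F, Finset.mem_image_of_mem _ hG, fun e => hGA (hinj hG hA e), ?_⟩
    intro H hH hne
    obtain ⟨H', hH', rfl⟩ := Finset.mem_image.1 hH
    have := h H' hH' (fun e => hne (by rw [e]))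
    intro x hx
    simp only [Finset.mem_inter, Finset.mem_sdiff] at hx ⊢
    have := this (Finset.mem_inter.2 ⟨hx.1.1, hx.2.1⟩)
    exact ⟨hx.1, (Finset.mem_inter.1 this).2, hx.1.2⟩

/-- This identifies the colon ideal by the monomial of `F`: a product with that monomial lies in the
ideal exactly when the other factor is divisible by the monomial of some `H \ F`. -/
theorem generates_image_sdiff {S : Finset (Finset V)} {F W : Finset V} :
    Generates (S.image (· \ F)) W ↔ Generates S (F ∪ W) := by
  constructor
  · rintro ⟨H, hH, hHW⟩
    obtain ⟨H', hH', rfl⟩ := Finset.mem_image.1 hH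
    exact ⟨H', hH', sdiff_le_iff.1 hHW⟩
  · rintro ⟨H, hH, hHW⟩
    exact ⟨H \ F, Finset.mem_image_of_mem _ hH, sdiff_le_iff.2 hHW⟩

theorem disjoint_sup_image_sdiff (S : Finset (Finset V)) (F : Finset V) :
    Disjoint F ((S.image (· \ F)).sup id) := by
  rw [Finset.disjoint_sup_right]
  intro H hH
  obtain ⟨H', -, rfl⟩ := Finset.mem_image.1 hH
  exact Finset.disjoint_sdiff

theorem generates_insert {S : Finset (Finset V)} {F W : Finset V} :
    Generates (insert F S) W ↔ Generates S W ∨ F ⊆ W := by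
  simp [Generates, or_comm]

/-- A leaf that is not contained in another facet has a free vertex. -/
theorem IsLeafOf.exists_free {S : Finset (Finset V)} {F : Finset V} (h : IsLeafOf S F)
    (hF : F.Nonempty) (hmax : ∀ H ∈ S, H ≠ F → ¬ F ⊆ H) :
    ∃ v ∈ F, v ∉ (S.erase F).sup id := by
  rcases h.2 with h' | ⟨G, hG, hGF, h'⟩
  · obtain ⟨v, hv⟩ := hF
    refine ⟨v, hv, ?_⟩
    rw [Finset.mem_sup]
    rintro ⟨H, hH, -⟩
    exact (Finset.mem_erase.1 hH).1 (h' H (Finset.mem_erase.1 hH).2)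
  · obtain ⟨v, hv, hvG⟩ := Finset.not_subset.1 (hmax G hG hGF)
    refine ⟨v, hv, ?_⟩
    rw [Finset.mem_sup]
    rintro ⟨H, hH, hvH⟩
    obtain ⟨hHF, hH⟩ := Finset.mem_erase.1 hH
    exact hvG (Finset.mem_inter.1 (h' H hH hHF (Finset.mem_inter.2 ⟨hv, hvH⟩))).2

/-- A forest with at least two facets has at least two leaves. -/
theorem IsForest.exists_leaf_ne {S : Finset (Finset V)} (hS : IsForest S) (hcard : 2 ≤ S.card)
    (F₀ : Finset V) : ∃ F, F ≠ F₀ ∧ IsLeafOf S F := by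
  induction hn : S.card generalizing S F₀ with
  | zero => omega
  | succ n ih =>
    obtain ⟨F, hF⟩ := hS S subset_rfl (Finset.card_pos.1 (by omega))
    by_cases hne : F = F₀
    swap
    · exact ⟨F, hne, hF⟩
    subst hne
    obtain ⟨hFS, h | ⟨G, hG, hGF, h⟩⟩ := hF
    · obtain ⟨H, hH, hHF⟩ := Finset.exists_mem_ne (by omega : 1 < S.card) F
      exact absurd (h H hH) hHF
    have hcard' : (S.erase F).card = n := by rw [Finset.card_erase_of_mem hFS, hn]; rfl
    have hGe : G ∈ S.erase F := Finset.mem_erase.2 ⟨hGF, hG⟩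
    by_cases h1 : n = 1
    · refine ⟨G, hGF, hG, Or.inr ⟨F, hFS, hGF.symm, fun H hH hHG => ?_⟩⟩
      have : H = F := by
        by_contra hHF
        exact hHG (Finset.card_le_one.1 (by omega : (S.erase F).card ≤ 1) H
          (Finset.mem_erase.2 ⟨hHF, hH⟩) G hGe)
      rw [this]
    -- The remaining family has a leaf `A ≠ G`. It is still a leaf once `F` is put back: `F ∩ A`
    -- lies in `G`, so `A ∩ F` lies in `A ∩ G`, which is already covered.
    · obtain ⟨A, hAG, hA, hA'⟩ := ih (hS.mono (Finset.erase_subset F S)) (by omega) G hcard'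
      obtain ⟨hAF, hAS⟩ := Finset.mem_erase.1 hA
      rcases hA' with hA' | ⟨C, hC, hCA, hA'⟩
      · exact absurd (hA' G hGe) hAG.symm
      refine ⟨A, hAF, hAS, Or.inr ⟨C, (Finset.mem_erase.1 hC).2, hCA, fun H hH hHA => ?_⟩⟩
      by_cases hHF : H = F
      · subst hHF
        refine subset_trans ?_ (hA' G hGe hAG.symm)
        intro x hx
        rw [Finset.inter_comm] at hx
        exact Finset.mem_inter.2 ⟨(Finset.mem_inter.1 hx).2,
          (Finset.mem_inter.1 (h A hAS hAF hx)).2⟩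
      · exact hA' H (Finset.mem_erase.2 ⟨hHF, hH⟩) hHA

/-- A generator divisible by another one is redundant. -/
theorem Generates.erase_iff {S : Finset (Finset V)} {F G : Finset V} (hF : F ∈ S) (hne : F ≠ G)
    (hFG : F ⊆ G) (W : Finset V) : Generates (S.erase G) W ↔ Generates S W := by
  constructor
  · rintro ⟨H, hH, hHW⟩
    exact ⟨H, Finset.mem_of_mem_erase hH, hHW⟩
  · rintro ⟨H, hH, hHW⟩
    by_cases hHG : H = G
    · exact ⟨F, Finset.mem_erase.2 ⟨hne, hF⟩, hFG.trans (hHG ▸ hHW)⟩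
    · exact ⟨H, Finset.mem_erase.2 ⟨hHG, hH⟩, hHW⟩

/-! ### Resolutions of forest ideals and their alternating sums -/

variable (K : Type*) [Field K]

/-- One step of the construction: attach a facet with a free vertex. -/
theorem exists_resolution_of_erase {S : Finset (Finset V)} {F : Finset V} (hF : F ∈ S) {v : V}
    (hvF : v ∈ F) (hv : v ∉ (S.erase F).sup id) {J' : Finset V → Prop} {U' : Finset V}
    (M : SquarefreeResolution K (Generates (S.erase F)) ((S.erase F).sup id))
    (N : SquarefreeResolution K J' U')
    (hJ : ∀ W, J' W ↔ Generates (S.erase F) (F ∪ W)) (hU : U' = ((S.erase F).image (· \ F)).sup id) :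
    ∃ C : SquarefreeResolution K (Generates S) (S.sup id),
      ∀ j, C.altSum j = M.altSum j - N.altSum (j - F.card + 1) := by
  subst hU
  obtain ⟨C, hC⟩ := M.exists_cone N F (fun _ _ => Generates.mono) hJ v hvF hv
    (disjoint_sup_image_sdiff _ _)
  have hsub : ∀ H ∈ S, H ⊆ S.sup id := fun H hH => Finset.le_sup (f := id) hH
  refine ⟨C.cast (fun W => ?_) ?_, fun j => (C.altSum_cast _ _ j).trans (hC j)⟩
  · rw [← generates_insert, Finset.insert_erase hF]
  · refine Finset.union_subset (Finset.sup_mono (Finset.erase_subset _ _))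
      (Finset.union_subset (hsub F hF) (Finset.sup_le fun H hH => ?_))
    obtain ⟨H', hH', rfl⟩ := Finset.mem_image.1 hH
    exact Finset.sdiff_subset.trans (hsub H' (Finset.mem_of_mem_erase hH'))

theorem sup_empty_resolution :
    ∃ C : SquarefreeResolution K (Generates (∅ : Finset (Finset V))) ((∅ : Finset (Finset V)).sup id),
      ∀ j, C.altSum j = if j = 0 then 1 else 0 :=
  ⟨(SquarefreeResolution.trivial K).cast (by simp [Generates]) (by simp),
    fun j => (SquarefreeResolution.altSum_cast _ _ _ j).trans
      (SquarefreeResolution.altSum_trivial j)⟩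

/-- The facet ideal of a forest has a finite minimal multigraded free resolution. -/
theorem IsForest.nonempty_resolution {S : Finset (Finset V)} (hS : IsForest S) (hne : ∅ ∉ S) :
    Nonempty (SquarefreeResolution K (Generates S) (S.sup id)) := by
  induction hn : S.card using Nat.strong_induction_on generalizing S with
  | _ n ih =>
  rcases S.eq_empty_or_nonempty with rfl | hSne
  · exact ⟨(sup_empty_resolution K).choose⟩
  obtain ⟨F, hF⟩ := hS S subset_rfl hSne
  -- Families arising from colon ideals need not be antichains; redundant generators are discarded
  -- until the leaf `F` is incomparable with all other members.
  have drop : ∀ A ∈ S, ∀ B ∈ S, A ≠ B → A ⊆ B →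
      Nonempty (SquarefreeResolution K (Generates S) (S.sup id)) := by
    intro A hA B hB hAB hsub
    obtain ⟨M⟩ := ih _ (by rw [← hn]; exact Finset.card_erase_lt_of_mem hB)
      (hS.mono (Finset.erase_subset B S)) (fun h => hne (Finset.mem_of_mem_erase h)) rfl
    exact ⟨M.cast (Generates.erase_iff hA hAB hsub) (Finset.sup_mono (Finset.erase_subset _ _))⟩
  by_cases h1 : ∃ G ∈ S, G ≠ F ∧ F ⊆ G
  · obtain ⟨G, hG, hGF, hsub⟩ := h1
    exact drop F hF.1 G hG hGF.symm hsub
  by_cases h2 : ∃ G ∈ S, G ≠ F ∧ G ⊆ F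
  · obtain ⟨G, hG, hGF, hsub⟩ := h2
    exact drop G hG F hF.1 hGF hsub
  push Not at h1 h2
  obtain ⟨v, hvF, hv⟩ := hF.exists_free
    (Finset.nonempty_iff_ne_empty.2 fun h => hne (h ▸ hF.1)) h1
  have hlt : (S.erase F).card < n := by rw [← hn]; exact Finset.card_erase_lt_of_mem hF.1
  have hS' := hS.mono (Finset.erase_subset F S)
  obtain ⟨M⟩ := ih _ hlt hS' (fun h => hne (Finset.mem_of_mem_erase h)) rfl
  -- No other member is contained in `F`, so the colon ideal is proper and the induction hypothesis
  -- applies to it.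
  obtain ⟨N⟩ := ih _ (Finset.card_image_le.trans_lt hlt) (hS'.image_sdiff F) (fun h => by
    obtain ⟨H, hH, hHF⟩ := Finset.mem_image.1 h
    obtain ⟨hHne, hH⟩ := Finset.mem_erase.1 hH
    exact h2 H hH hHne (Finset.sdiff_eq_empty_iff_subset.1 hHF)) rfl
  exact ⟨(exists_resolution_of_erase K hF.1 hvF hv M N (fun W => generates_image_sdiff)
    rfl).choose⟩

/-- If some facet exceeds `F` by one vertex, then all alternating sums of the colon ideal by `F`
vanish. -/
theorem IsForest.exists_colon_resolution {S : Finset (Finset V)} (hS : IsForest S) {F G : Finset V}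
    (hG : G ∈ S) (hGF : (G \ F).card = 1) (hS' : ∀ H ∈ S, ¬ H ⊆ F) :
    ∃ N : SquarefreeResolution K (Generates (S.image (· \ F))) ((S.image (· \ F)).sup id),
      ∀ j, N.altSum j = 0 := by
  obtain ⟨v, hv⟩ := Finset.card_eq_one.1 hGF
  have hGm : {v} ∈ S.image (· \ F) := Finset.mem_image.2 ⟨G, hG, hv⟩
  set T := (S.image (· \ F)) with hT
  -- The colon ideal contains the variable `v`, so its generators divisible by `v` may be replaced
  -- by `v` alone; `L` collects the others.
  set L := T.filter (v ∉ ·) with hL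
  have hLT : L ⊆ T := Finset.filter_subset _ _
  have hvL : v ∉ L.sup id := by
    rw [Finset.mem_sup]
    rintro ⟨H, hH, hvH⟩
    exact (Finset.mem_filter.1 hH).2 hvH
  obtain ⟨N⟩ := ((hS.image_sdiff F).mono hLT).nonempty_resolution K (fun h => by
    obtain ⟨H, hH, hHF⟩ := Finset.mem_image.1 (hLT h)
    exact hS' H hH (Finset.sdiff_eq_empty_iff_subset.1 hHF))
  -- As `v` is a nonzerodivisor modulo the ideal of `L`, the colon ideal of that ideal by `v` is the
  -- ideal itself, and `N` serves at both ends of the cone.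
  obtain ⟨C, hC⟩ := N.exists_cone N {v} (fun _ _ => Generates.mono) (fun W =>
    ⟨Generates.mono Finset.subset_union_right, fun ⟨H, hH, hHW⟩ => ⟨H, hH, fun x hx =>
      (Finset.mem_union.1 (hHW hx)).resolve_left fun hxv =>
        (Finset.mem_filter.1 hH).2 (Finset.mem_singleton.1 hxv ▸ hx)⟩⟩)
    v (Finset.mem_singleton_self v) hvL (Finset.disjoint_singleton_left.2 hvL)
  refine ⟨C.cast (fun W => ⟨?_, ?_⟩) ?_, fun j => ?_⟩
  · rintro (h | h)
    · obtain ⟨H, hH, hHW⟩ := h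
      exact ⟨H, hLT hH, hHW⟩
    · exact ⟨{v}, hGm, h⟩
  · rintro ⟨H, hH, hHW⟩
    by_cases hvH : v ∈ H
    · exact Or.inr (Finset.singleton_subset_iff.2 (hHW hvH))
    · exact Or.inl ⟨H, Finset.mem_filter.2 ⟨hH, hvH⟩, hHW⟩
  · have h1 : L.sup id ⊆ T.sup id := Finset.sup_mono hLT
    exact Finset.union_subset h1 (Finset.union_subset (Finset.le_sup (f := id) hGm) h1)
  -- The shift is `j - 1 + 1 = j`, so the two alternating sums cancel.
  · rw [SquarefreeResolution.altSum_cast, hC]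
    simp

/-- `G` can follow `F` in a proper chain of facets in `S`. -/
def ProperStep (S : Finset (Finset V)) (F G : Finset V) : Prop :=
  F ∈ S ∧ G ∈ S ∧ (F ∩ G).card + 1 = G.card

theorem ProperStep.ne {S : Finset (Finset V)} {F G : Finset V} (h : ProperStep S F G) : F ≠ G := by
  rintro rfl
  have := h.2.2
  rw [Finset.inter_self] at this
  omega

/-- Removing a leaf does not destroy connectedness by proper steps. -/
theorem IsLeafOf.reflTransGen_erase {S : Finset (Finset V)} {F : Finset V} (hF : IsLeafOf S F)
    (hS : ∀ A ∈ S, ∀ B ∈ S, A ⊆ B → A = B) {A B : Finset V}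
    (h : Relation.ReflTransGen (ProperStep S) A B) (hA : A ≠ F) (hB : B ≠ F) :
    Relation.ReflTransGen (ProperStep (S.erase F)) A B := by
  -- For induction along the chain, a start at `F` must be covered as well: there the claim is made
  -- for every possible predecessor `Y` of `F`, so that the chain can bypass `F`.
  suffices key : (A ≠ F → Relation.ReflTransGen (ProperStep (S.erase F)) A B) ∧
      (A = F → ∀ Y, ProperStep S Y F → Relation.ReflTransGen (ProperStep (S.erase F)) Y B) from
    key.1 hA
  clear hA
  have herase : ∀ {X Y}, ProperStep S X Y → X ≠ F → Y ≠ F → ProperStep (S.erase F) X Y :=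
    fun h hX hY => ⟨Finset.mem_erase.2 ⟨hX, h.1⟩, Finset.mem_erase.2 ⟨hY, h.2.1⟩, h.2.2⟩
  induction h using Relation.ReflTransGen.head_induction_on with
  | refl => exact ⟨fun _ => .refl, fun h => absurd h hB⟩
  | head hstep hrest ih =>
    rename_i X X'
    refine ⟨fun hX => ?_, ?_⟩
    · by_cases hX' : X' = F
      · exact ih.2 hX' X (hX' ▸ hstep)
      · exact .head (herase hstep hX hX') (ih.1 hX')
    · rintro rfl Y hY
      have hX' : X' ≠ X := hstep.ne.symm
      have hYX : Y ≠ X := hY.ne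
      rcases hF.2 with hF' | ⟨G, hG, hGX, hF'⟩
      · exact absurd (hF' Y hY.1) hYX
      have hlt : (X ∩ G).card < X.card := Finset.card_lt_card
        (Finset.ssubset_iff_subset_ne.2 ⟨Finset.inter_subset_left, fun e =>
          hGX (hS X hF.1 G hG (Finset.inter_eq_left.1 e)).symm⟩)
      have hYc := hY.2.2
      rw [Finset.inter_comm] at hYc
      -- `X` is the leaf. The step from `Y` to `X` makes `X ∩ Y` miss just one vertex of `X`, while
      -- `X ∩ G` is a proper subset of `X` containing it; so they agree, and `Y` can play the role
      -- of `G`.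
      have hXY : X ∩ Y = X ∩ G :=
        Finset.eq_of_subset_of_card_le (hF' Y hY.1 hYX) (by omega)
      have hsub : X ∩ X' ⊆ Y ∩ X' := by
        intro x hx
        have hx' := hF' X' hstep.2.1 hX' hx
        rw [← hXY] at hx'
        exact Finset.mem_inter.2 ⟨(Finset.mem_inter.1 hx').2, (Finset.mem_inter.1 hx).2⟩
      by_cases hYX' : Y = X'
      · exact hYX' ▸ ih.1 hX'
      -- `Y ∩ X'` contains `X ∩ X'`, which misses one vertex of `X'`, and by incomparability it is
      -- not all of `X'`; so `Y` to `X'` is a proper step.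
      · refine .head (herase ⟨hY.1, hstep.2.1, ?_⟩ hYX hX') (ih.1 hX')
        have h1 := Finset.card_le_card hsub
        have h2 : (Y ∩ X').card < X'.card := Finset.card_lt_card
          (Finset.ssubset_iff_subset_ne.2 ⟨Finset.inter_subset_right, fun e =>
            hYX' (hS X' hstep.2.1 Y hY.1 (Finset.inter_eq_right.1 e)).symm⟩)
        have := hstep.2.2
        omega

/-- A forest that is connected in codimension one has a finite minimal multigraded free resolution
with the alternating sum property. -/
theorem IsForest.exists_resolution_altSum {S : Finset (Finset V)} (hS : IsForest S)
    (hne : ∅ ∉ S) (hanti : ∀ A ∈ S, ∀ B ∈ S, A ⊆ B → A = B)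
    (hconn : ∀ A ∈ S, ∀ B ∈ S, B.card ≤ A.card → Relation.ReflTransGen (ProperStep S) A B)
    {F₀ : Finset V} (hF₀ : F₀ ∈ S) (hmin : ∀ A ∈ S, F₀.card ≤ A.card) :
    ∃ M : SquarefreeResolution K (Generates S) (S.sup id),
      ∀ j : ℤ, M.altSum j = (if j = 0 then 1 else 0) - if j = F₀.card - 1 then 1 else 0 := by
  induction hn : S.card generalizing S with
  | zero =>
    rw [Finset.card_eq_zero] at hn
    simp [hn] at hF₀
  | succ n ih =>
    by_cases h1 : S.card = 1
    · obtain ⟨A, rfl⟩ := Finset.card_eq_one.1 h1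
      obtain rfl := Finset.mem_singleton.1 hF₀
      obtain ⟨v, hv⟩ : F₀.Nonempty := Finset.nonempty_iff_ne_empty.2 fun h => hne (h ▸ hF₀)
      -- For a single facet both ends of the cone resolve `R`, giving `1` in strand `0` and `-1` in
      -- strand `|F₀| - 1`.
      obtain ⟨C, hC⟩ := exists_resolution_of_erase K hF₀ hv (by simp)
        ((sup_empty_resolution (V := V) K).choose.cast (J' := Generates (({F₀} : Finset _).erase F₀))
          (U' := (({F₀} : Finset (Finset V)).erase F₀).sup id) (by simp) (by simp))
        (sup_empty_resolution (V := V) K).choose (fun W => by simp [Generates]) (by simp)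
      refine ⟨C, fun j => ?_⟩
      rw [hC, SquarefreeResolution.altSum_cast, (sup_empty_resolution (V := V) K).choose_spec,
        (sup_empty_resolution (V := V) K).choose_spec]
      congr 2
      exact propext ⟨fun h => by omega, fun h => by omega⟩
    -- Sparing `F₀` keeps the least cardinality unchanged, and with it the right-hand side.
    obtain ⟨F, hFF₀, hF⟩ := hS.exists_leaf_ne (by omega) F₀
    have hFe : ∀ A ∈ S.erase F, A ∈ S := fun A hA => Finset.mem_of_mem_erase hA
    have hF₀e : F₀ ∈ S.erase F := Finset.mem_erase.2 ⟨hFF₀.symm, hF₀⟩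
    have hS' := hS.mono (Finset.erase_subset F S)
    obtain ⟨M, hM⟩ := ih hS' (fun h => hne (hFe _ h))
      (fun A hA B hB => hanti A (hFe A hA) B (hFe B hB))
      (fun A hA B hB hAB => hF.reflTransGen_erase hanti (hconn A (hFe A hA) B (hFe B hB) hAB)
        (Finset.ne_of_mem_erase hA) (Finset.ne_of_mem_erase hB))
      hF₀e (fun A hA => hmin A (hFe A hA)) (by rw [Finset.card_erase_of_mem hF.1, hn]; rfl)
    obtain ⟨v, hvF, hv⟩ := hF.exists_free
      (Finset.nonempty_iff_ne_empty.2 fun h => hne (h ▸ hF.1))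
      (fun H hH hHF h => hHF (hanti F hF.1 H hH h).symm)
    -- The chain runs from the larger facet to the smaller one, so its first step bounds `G \ F`, as
    -- needed for the colon ideal by `F`.
    rcases (hconn F hF.1 F₀ hF₀ (hmin F hF.1)).cases_head with h | ⟨G, hstep, -⟩
    · exact absurd h hFF₀
    obtain ⟨N, hN⟩ := hS'.exists_colon_resolution K (F := F) (G := G)
      (Finset.mem_erase.2 ⟨hstep.ne.symm, hstep.2.1⟩)
      (by
        have h1 := Finset.card_sdiff_add_card_inter G F
        have h2 := hstep.2.2
        rw [Finset.inter_comm] at h2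
        omega)
      (fun H hH h => Finset.ne_of_mem_erase hH (hanti H (hFe H hH) F hF.1 h))
    obtain ⟨C, hC⟩ := exists_resolution_of_erase K hF.1 hvF hv M N
      (fun W => generates_image_sdiff) rfl
    exact ⟨C, fun j => by rw [hC, hN, hM, sub_zero]⟩

end Forests

/-! ### Graded maps between free modules over the polynomial ring -/

section Grading

variable {V : Type*} {K : Type*} [Field K]

/-- The component of degree `k`. -/
noncomputable def intComponent (k : ℤ) : MvPolynomial V K →ₗ[K] MvPolynomial V K :=
  weightedHomogeneousComponent (1 : V → ℤ) k

theorem coeff_intComponent (k : ℤ) (f : MvPolynomial V K) (m : V →₀ ℕ) :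
    coeff m (intComponent k f) = if ((Finsupp.degree m : ℕ) : ℤ) = k then coeff m f else 0 := by
  classical
  rw [intComponent, coeff_weightedHomogeneousComponent]
  congr 2
  simp [Finsupp.weight_apply, Finsupp.degree_apply, Finsupp.sum]

theorem intComponent_of_hasIntDegree {k : ℤ} {f : MvPolynomial V K} (hf : HasIntDegree f k) :
    intComponent k f = f := by
  ext m
  rw [coeff_intComponent]
  by_cases h : coeff m f = 0
  · simp [h]
  · rw [if_pos (hf m (mem_support_iff.2 h))]

theorem hasIntDegree_intComponent (k : ℤ) (f : MvPolynomial V K) :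
    HasIntDegree (intComponent k f) k := by
  intro m hm
  rw [mem_support_iff, coeff_intComponent] at hm
  by_contra h
  exact hm (if_neg h)

theorem intComponent_mul {e : ℤ} {f : MvPolynomial V K} (hf : HasIntDegree f e) (k : ℤ)
    (g : MvPolynomial V K) : intComponent k (g * f) = intComponent (k - e) g * f := by
  classical
  ext m
  rw [coeff_intComponent, coeff_mul, coeff_mul]
  have h0 : ∀ x ∈ Finset.HasAntidiagonal.antidiagonal m,
      coeff x.1 (intComponent (k - e) g) * coeff x.2 f =
        if ((Finsupp.degree m : ℕ) : ℤ) = k then coeff x.1 g * coeff x.2 f else 0 := by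
    intro x hx
    rw [coeff_intComponent]
    by_cases h : coeff x.2 f = 0
    · simp [h]
    · have h1 := hf _ (mem_support_iff.2 h)
      have h2 : Finsupp.degree m = Finsupp.degree x.1 + Finsupp.degree x.2 := by
        rw [← Finset.HasAntidiagonal.mem_antidiagonal.1 hx, map_add]
      have h3 : ((Finsupp.degree x.1 : ℕ) : ℤ) = k - e ↔ ((Finsupp.degree m : ℕ) : ℤ) = k := by
        rw [h2]
        push_cast
        omega
      simp only [h3, ite_mul, zero_mul]
  rw [Finset.sum_congr rfl h0]
  split_ifs <;> simp

theorem constantCoeff_eq_zero_of_hasIntDegree {k : ℤ} {f : MvPolynomial V K}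
    (hf : HasIntDegree f k) (hk : k ≠ 0) : constantCoeff f = 0 := by
  by_contra h
  exact hk (by simpa using (hf 0 (mem_support_iff.2 h)).symm)

theorem constantCoeff_eq_zero_of_mem_span_X {f : MvPolynomial V K}
    (hf : f ∈ Ideal.span (Set.range (X : V → MvPolynomial V K))) : constantCoeff f = 0 := by
  have : Ideal.span (Set.range (X : V → MvPolynomial V K)) ≤ RingHom.ker constantCoeff := by
    rw [Ideal.span_le]
    rintro _ ⟨v, rfl⟩
    simp [RingHom.mem_ker]
  exact this hf

section Maps

variable {m n l : Type*} [Fintype n] [DecidableEq n]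

/-- The map `θ` preserves degrees, when the basis vectors of source and target have degrees `s`
and `t`. -/
def IsGradedMap (s : n → ℤ) (t : m → ℤ)
    (θ : (n → MvPolynomial V K) →ₗ[MvPolynomial V K] (m → MvPolynomial V K)) : Prop :=
  ∀ b a, HasIntDegree (θ (Pi.single b 1) a) (s b - t a)

/-- The component of degree `k` of a vector. -/
noncomputable def vecComponent (s : n → ℤ) (k : ℤ) (p : n → MvPolynomial V K) :
    n → MvPolynomial V K :=
  fun a => intComponent (k - s a) (p a)

theorem linearMap_eq_sum {N : Type*} [AddCommGroup N] [Module (MvPolynomial V K) N]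
    (θ : (n → MvPolynomial V K) →ₗ[MvPolynomial V K] N)
    (p : n → MvPolynomial V K) : θ p = ∑ b, p b • θ (Pi.single b 1) := by
  conv_lhs => rw [pi_eq_sum_univ' p, map_sum]
  refine Finset.sum_congr rfl fun b _ => ?_
  rw [map_smul]

theorem IsGradedMap.map_vecComponent {s : n → ℤ} {t : m → ℤ}
    {θ : (n → MvPolynomial V K) →ₗ[MvPolynomial V K] (m → MvPolynomial V K)}
    (hθ : IsGradedMap s t θ) (k : ℤ) (p : n → MvPolynomial V K) :
    θ (vecComponent s k p) = vecComponent t k (θ p) := by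
  funext a
  rw [linearMap_eq_sum θ (vecComponent s k p)]
  simp only [vecComponent]
  rw [linearMap_eq_sum θ p]
  simp only [Finset.sum_apply, Pi.smul_apply, smul_eq_mul, map_sum]
  refine Finset.sum_congr rfl fun b _ => ?_
  rw [intComponent_mul (hθ b a)]
  congr 2
  ring_nf

theorem exists_linearMap {N : Type*} [AddCommGroup N] [Module (MvPolynomial V K) N] (q : n → N) :
    ∃ θ : (n → MvPolynomial V K) →ₗ[MvPolynomial V K] N, ∀ b, θ (Pi.single b 1) = q b :=
  ⟨(Pi.basisFun (MvPolynomial V K) n).constr (MvPolynomial V K) q, fun b => by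
    rw [← Pi.basisFun_apply, Module.Basis.constr_basis]⟩

theorem linearMap_ext {N : Type*} [AddCommGroup N] [Module (MvPolynomial V K) N]
    {θ η : (n → MvPolynomial V K) →ₗ[MvPolynomial V K] N}
    (h : ∀ b, θ (Pi.single b 1) = η (Pi.single b 1)) (p : n → MvPolynomial V K) : θ p = η p := by
  rw [linearMap_eq_sum θ, linearMap_eq_sum η]
  simp only [h]

theorem exists_lift
    (d : (m → MvPolynomial V K) →ₗ[MvPolynomial V K] (l → MvPolynomial V K))
    (ψ : (n → MvPolynomial V K) →ₗ[MvPolynomial V K] (l → MvPolynomial V K))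
    (h : ∀ p, ψ p ∈ Set.range d) :
    ∃ θ : (n → MvPolynomial V K) →ₗ[MvPolynomial V K] (m → MvPolynomial V K),
      ∀ p, d (θ p) = ψ p := by
  choose q hq using fun b => h (Pi.single b 1)
  obtain ⟨θ, hθ⟩ := exists_linearMap (V := V) (K := K) q
  exact ⟨θ, fun p => linearMap_ext (θ := d ∘ₗ θ) (fun b => by simp [hθ, hq]) p⟩

/-- Arbitrary preimages of the vectors `ψ e_b` can be replaced by their components of degree `s b`:
the graded map `d` commutes with taking components, and `ψ e_b` is its own component. -/
theorem exists_graded_lift [Fintype m] [DecidableEq m] {s : n → ℤ} {t : m → ℤ} {u : l → ℤ}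
    {d : (m → MvPolynomial V K) →ₗ[MvPolynomial V K] (l → MvPolynomial V K)}
    {ψ : (n → MvPolynomial V K) →ₗ[MvPolynomial V K] (l → MvPolynomial V K)}
    (hd : IsGradedMap t u d) (hψ : IsGradedMap s u ψ) (h : ∀ p, ψ p ∈ Set.range d) :
    ∃ θ : (n → MvPolynomial V K) →ₗ[MvPolynomial V K] (m → MvPolynomial V K),
      IsGradedMap s t θ ∧ ∀ p, d (θ p) = ψ p := by
  choose q hq using fun b => h (Pi.single b 1)
  obtain ⟨θ, hθ⟩ := exists_linearMap (V := V) (K := K) fun b => vecComponent t (s b) (q b)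
  refine ⟨θ, fun b a => ?_, fun p => linearMap_ext (θ := d ∘ₗ θ) (fun b => ?_) p⟩
  · rw [hθ]
    exact hasIntDegree_intComponent _ _
  · rw [LinearMap.comp_apply, hθ, hd.map_vecComponent, hq]
    funext a
    exact intComponent_of_hasIntDegree (hψ b a)

/-- Graded maps whose composition is the identity modulo the variables cannot decrease the number
of basis vectors of a given degree. -/
theorem card_le_of_comp_eq_one [Fintype m] [DecidableEq m] {s : n → ℤ} {t : m → ℤ}
    {θ : (n → MvPolynomial V K) →ₗ[MvPolynomial V K] (m → MvPolynomial V K)}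
    {η : (m → MvPolynomial V K) →ₗ[MvPolynomial V K] (n → MvPolynomial V K)}
    (hθ : IsGradedMap s t θ)
    (h : ∀ b a, constantCoeff (η (θ (Pi.single b 1)) a) =
      constantCoeff ((Pi.single b 1 : n → MvPolynomial V K) a)) (k : ℤ) :
    Nat.card {b // s b = k} ≤ Nat.card {a // t a = k} := by
  classical
  let A : Matrix {b // s b = k} {a // t a = k} K :=
    fun b a => constantCoeff (θ (Pi.single b.1 1) a.1)
  let B : Matrix {a // t a = k} {b // s b = k} K :=
    fun a b => constantCoeff (η (Pi.single a.1 1) b.1)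
  have hAB : A * B = 1 := by
    ext b b'
    have h1 := h b.1 b'.1
    rw [linearMap_eq_sum η, Finset.sum_apply, map_sum] at h1
    -- Basis vectors outside degree `k` do not contribute to the constant terms, because the
    -- relevant entries of `θ` are forms of nonzero degree.
    rw [Matrix.mul_apply, Fintype.sum_of_injective (Subtype.val : {a // t a = k} → m)
      Subtype.val_injective (fun a => A b a * B a b')
      (fun a => constantCoeff ((θ (Pi.single b.1 1) a • η (Pi.single a 1)) b'.1))
      (fun a ha => ?_) (fun a => ?_), h1]
    · rw [Matrix.one_apply, Pi.single_apply]
      simp only [eq_comm, Subtype.ext_iff]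
      split_ifs <;> simp
    · have hc : constantCoeff (θ (Pi.single b.1 1) a) = 0 :=
        constantCoeff_eq_zero_of_hasIntDegree (hθ b.1 a) fun h0 =>
          ha ⟨⟨a, by rw [← b.2]; omega⟩, rfl⟩
      simp [hc]
    · simp [A, B]
  rw [Nat.card_eq_fintype_card, Nat.card_eq_fintype_card]
  calc _ = (A * B).rank := by rw [hAB, Matrix.rank_one]
    _ ≤ A.rank := Matrix.rank_mul_le_left _ _
    _ ≤ _ := Matrix.rank_le_card_width _

end Maps

theorem IsGradedMap.comp {n m l : Type*} [DecidableEq n] [Fintype m] [DecidableEq m] {s : n → ℤ} {t : m → ℤ} {u : l → ℤ}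
    {d : (m → MvPolynomial V K) →ₗ[MvPolynomial V K] (l → MvPolynomial V K)}
    {θ : (n → MvPolynomial V K) →ₗ[MvPolynomial V K] (m → MvPolynomial V K)}
    (hd : IsGradedMap t u d) (hθ : IsGradedMap s t θ) : IsGradedMap s u (d ∘ₗ θ) := by
  intro b a
  have h1 : vecComponent t (s b) (θ (Pi.single b 1)) = θ (Pi.single b 1) :=
    funext fun c => intComponent_of_hasIntDegree (hθ b c)
  rw [LinearMap.comp_apply, ← h1, hd.map_vecComponent]
  exact hasIntDegree_intComponent _ _

/-! ### Uniqueness of graded Betti numbers -/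

namespace MinimalGradedFreeResolution

variable {I : Ideal (MvPolynomial V K)}

theorem constantCoeff_diff (P : MinimalGradedFreeResolution I) (i : ℕ)
    (p : Fin (P.rank (i + 1)) → MvPolynomial V K) (a : Fin (P.rank i)) :
    constantCoeff (P.diff i p a) = 0 := by
  rw [linearMap_eq_sum (P.diff i), Finset.sum_apply, map_sum]
  refine Finset.sum_eq_zero fun b _ => ?_
  rw [Pi.smul_apply, smul_eq_mul, map_mul, constantCoeff_eq_zero_of_mem_span_X (P.minimal i b a),
    mul_zero]

/-- The start of the comparison. Degrees in `R ⧸ I` are read off from homogeneous representatives;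
since `I` is homogeneous (`hI`), passing to a component of a lift does not change the class it
represents. -/
theorem exists_graded_lift_aug (hI : ∀ k, ∀ f ∈ I, intComponent k f ∈ I)
    (P Q : MinimalGradedFreeResolution I) :
    ∃ θ : (Fin (P.rank 0) → MvPolynomial V K) →ₗ[MvPolynomial V K]
        (Fin (Q.rank 0) → MvPolynomial V K),
      IsGradedMap (P.shift 0) (Q.shift 0) θ ∧ ∀ p, Q.aug (θ p) = P.aug p := by
  choose f hf hf' using P.aug_graded
  choose g hg hg' using Q.aug_graded
  choose q hq using fun b => Q.aug_surjective (Ideal.Quotient.mk I (f b))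
  have haug : ∀ p, Q.aug p = Ideal.Quotient.mk I (∑ c, p c * g c) := fun p => by
    rw [linearMap_eq_sum Q.aug, map_sum]
    refine Finset.sum_congr rfl fun c _ => ?_
    rw [hg', map_mul]
    rfl
  obtain ⟨θ, hθ⟩ := exists_linearMap (V := V) (K := K) fun b => vecComponent (Q.shift 0) (P.shift 0 b) (q b)
  refine ⟨θ, fun b a => ?_, fun p => linearMap_ext (θ := Q.aug ∘ₗ θ) (fun b => ?_) p⟩
  · rw [hθ]
    exact hasIntDegree_intComponent _ _
  · rw [LinearMap.comp_apply, hθ, hf', haug]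
    have h1 : ∑ c, vecComponent (Q.shift 0) (P.shift 0 b) (q b) c * g c =
        intComponent (P.shift 0 b) (∑ c, q b c * g c) := by
      rw [map_sum]
      exact Finset.sum_congr rfl fun c _ => (intComponent_mul (hg c) _ _).symm
    rw [h1, ← intComponent_of_hasIntDegree (hf b), Ideal.Quotient.eq, ← map_sub]
    refine hI _ _ (Ideal.Quotient.eq.1 ?_)
    rw [← haug, hq]

/-- Any two minimal graded free resolutions are homotopy equivalent by graded maps; this is the
part of the homotopy equivalence in homological degree `i`. -/
theorem exists_homotopy_equiv (hI : ∀ k, ∀ f ∈ I, intComponent k f ∈ I)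
    (P Q : MinimalGradedFreeResolution I) (i : ℕ) :
    ∃ (θ : (Fin (P.rank i) → MvPolynomial V K) →ₗ[MvPolynomial V K]
        (Fin (Q.rank i) → MvPolynomial V K))
      (η : (Fin (Q.rank i) → MvPolynomial V K) →ₗ[MvPolynomial V K]
        (Fin (P.rank i) → MvPolynomial V K))
      (h : (Fin (P.rank i) → MvPolynomial V K) →ₗ[MvPolynomial V K]
        (Fin (P.rank (i + 1)) → MvPolynomial V K)),
      IsGradedMap (P.shift i) (Q.shift i) θ ∧ IsGradedMap (Q.shift i) (P.shift i) η ∧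
      (∀ p, θ (P.diff i p) ∈ Set.range (Q.diff i)) ∧
      (∀ q, η (Q.diff i q) ∈ Set.range (P.diff i)) ∧
      (∀ p, η (θ (P.diff i p)) - P.diff i p = P.diff i (h (P.diff i p))) ∧
      ∀ b a, constantCoeff (η (θ (Pi.single b 1)) a) =
        constantCoeff ((Pi.single b 1 : Fin (P.rank i) → MvPolynomial V K) a) := by
  induction i with
  | zero =>
    obtain ⟨θ, hθ, hθ'⟩ := exists_graded_lift_aug hI P Q
    obtain ⟨η, hη, hη'⟩ := exists_graded_lift_aug hI Q P
    obtain ⟨h, hh⟩ := exists_lift (P.diff 0) (η ∘ₗ θ - LinearMap.id) fun p => by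
      refine (P.exact_zero _).1 ?_
      simp [hη', hθ']
    have hh' : ∀ p, η (θ p) - p = P.diff 0 (h p) := fun p => (hh p).symm
    refine ⟨θ, η, h, hθ, hη, fun p => ?_, fun q => ?_, fun p => hh' _, fun b a => ?_⟩
    · refine (Q.exact_zero _).1 ?_
      rw [hθ']
      exact P.exact_zero.apply_apply_eq_zero p
    · refine (P.exact_zero _).1 ?_
      rw [hη']
      exact Q.exact_zero.apply_apply_eq_zero q
    · rw [← sub_eq_zero, ← map_sub, ← Pi.sub_apply, hh', P.constantCoeff_diff]
  | succ i ih =>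
    -- The induction needs only that `θ` and `η` preserve boundaries, so that they lift one degree
    -- up, and that `η θ - 1 = d h` on boundaries, where the other homotopy term `h d` vanishes.
    obtain ⟨θ, η, h, hθ, hη, hθ', hη', hh, -⟩ := ih
    have hP : IsGradedMap (P.shift (i + 1)) (P.shift i) (P.diff i) := P.diff_graded i
    have hQ : IsGradedMap (Q.shift (i + 1)) (Q.shift i) (Q.diff i) := Q.diff_graded i
    obtain ⟨θ₁, hθ₁, hθ₁'⟩ := exists_graded_lift hQ (hθ.comp hP) hθ'
    obtain ⟨η₁, hη₁, hη₁'⟩ := exists_graded_lift hP (hη.comp hQ) hη'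
    simp only [LinearMap.comp_apply] at hθ₁' hη₁'
    obtain ⟨h₁, hh₁⟩ := exists_lift (P.diff (i + 1))
      (η₁ ∘ₗ θ₁ - LinearMap.id - h ∘ₗ P.diff i) fun p => by
        refine (P.exact_succ i _).1 ?_
        simp [hη₁', hθ₁', hh]
    have hh₁' : ∀ p, P.diff (i + 1) (h₁ p) = η₁ (θ₁ p) - p - h (P.diff i p) := hh₁
    refine ⟨θ₁, η₁, h₁, hθ₁, hη₁, fun p => ?_, fun q => ?_, fun p => ?_, fun b a => ?_⟩
    · refine (Q.exact_succ i _).1 ?_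
      rw [hθ₁', (P.exact_succ i).apply_apply_eq_zero, map_zero]
    · refine (P.exact_succ i _).1 ?_
      rw [hη₁', (Q.exact_succ i).apply_apply_eq_zero, map_zero]
    · rw [hh₁', (P.exact_succ i).apply_apply_eq_zero, map_zero, sub_zero]
    -- By minimality both homotopy terms `d h₁` and `h d` have entries without constant term.
    · have e1 : η₁ (θ₁ (Pi.single b 1)) = P.diff (i + 1) (h₁ (Pi.single b 1)) + Pi.single b 1 +
          h (P.diff i (Pi.single b 1)) := by
        rw [hh₁']
        abel
      have e2 : constantCoeff (h (P.diff i (Pi.single b 1)) a) = 0 := by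
        rw [linearMap_eq_sum h, Finset.sum_apply, map_sum]
        exact Finset.sum_eq_zero fun c _ => by
          rw [Pi.smul_apply, smul_eq_mul, map_mul, P.constantCoeff_diff, zero_mul]
      rw [e1, Pi.add_apply, Pi.add_apply, map_add, map_add, P.constantCoeff_diff, e2, zero_add,
        add_zero]

/-- The graded Betti numbers do not depend on the resolution. -/
theorem betti_eq (hI : ∀ k, ∀ f ∈ I, intComponent k f ∈ I)
    (P Q : MinimalGradedFreeResolution I) (i : ℕ) (k : ℤ) : P.betti i k = Q.betti i k := by
  apply le_antisymm
  · obtain ⟨θ, η, -, hθ, -, -, -, -, h⟩ := exists_homotopy_equiv hI P Q i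
    exact card_le_of_comp_eq_one hθ h k
  · obtain ⟨θ, η, -, hθ, -, -, -, -, h⟩ := exists_homotopy_equiv hI Q P i
    exact card_le_of_comp_eq_one hθ h k

end MinimalGradedFreeResolution

end Grading

/-! ### From scalar matrices to resolutions over the polynomial ring -/

section Translation

open Matrix

variable {V : Type*}

namespace SquarefreeResolution

variable {K : Type*} [Field K] {J : Finset V → Prop} {U : Finset V} (M : SquarefreeResolution K J U)

/-- The number of basis vectors in homological degree `i`. -/
noncomputable def rank (i : ℕ) : ℕ := Fintype.card {a // M.idx a = i}

/-- The basis vectors in homological degree `i`. -/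
noncomputable def basisVec (i : ℕ) (x : Fin (M.rank i)) : M.ι :=
  ((Fintype.equivFin {a // M.idx a = i}).symm x).1

theorem idx_basisVec (i : ℕ) (x : Fin (M.rank i)) : M.idx (M.basisVec i x) = i :=
  ((Fintype.equivFin {a // M.idx a = i}).symm x).2

theorem basisVec_injective (i : ℕ) : Function.Injective (M.basisVec i) :=
  Subtype.val_injective.comp (Equiv.injective _)

theorem exists_basisVec {i : ℕ} {a : M.ι} (h : M.idx a = i) : ∃ x, M.basisVec i x = a :=
  ⟨Fintype.equivFin {a // M.idx a = i} ⟨a, h⟩, by simp [basisVec]⟩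

/-- Include the vectors of homological degree `i` into all vectors. -/
noncomputable def incl (i : ℕ) : (Fin (M.rank i) → MvPolynomial V K) →ₗ[MvPolynomial V K]
    (M.ι → MvPolynomial V K) :=
  Function.ExtendByZero.linearMap _ (M.basisVec i)

/-- The part of homological degree `i` of a vector. -/
noncomputable def restr (i : ℕ) : (M.ι → MvPolynomial V K) →ₗ[MvPolynomial V K]
    (Fin (M.rank i) → MvPolynomial V K) :=
  LinearMap.funLeft _ _ (M.basisVec i)

theorem incl_apply_basisVec (i : ℕ) (p : Fin (M.rank i) → MvPolynomial V K) (x : Fin (M.rank i)) :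
    M.incl i p (M.basisVec i x) = p x :=
  (M.basisVec_injective i).extend_apply _ _ _

theorem idx_of_incl {i : ℕ} {p : Fin (M.rank i) → MvPolynomial V K} {a : M.ι}
    (h : M.incl i p a ≠ 0) : M.idx a = i := by
  by_contra hc
  refine h (Function.extend_apply' _ _ _ ?_)
  rintro ⟨x, rfl⟩
  exact hc (M.idx_basisVec i x)

theorem restr_incl (i : ℕ) (p : Fin (M.rank i) → MvPolynomial V K) :
    M.restr i (M.incl i p) = p :=
  funext fun x => M.incl_apply_basisVec i p x

theorem incl_restr {i : ℕ} {f : M.ι → MvPolynomial V K} (hf : ∀ a, f a ≠ 0 → M.idx a = i) :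
    M.incl i (M.restr i f) = f := by
  funext a
  by_cases h : M.idx a = i
  · obtain ⟨x, rfl⟩ := M.exists_basisVec h
    exact M.incl_apply_basisVec i _ x
  · have h1 : f a = 0 := by
      by_contra hc
      exact h (hf a hc)
    rw [h1]
    by_contra hc
    exact h (M.idx_of_incl hc)

theorem incl_single (i : ℕ) (x : Fin (M.rank i)) :
    M.incl i (Pi.single x 1) = Pi.single (M.basisVec i x) 1 := by
  funext a
  by_cases h : M.idx a = i
  · obtain ⟨y, rfl⟩ := M.exists_basisVec h
    rw [M.incl_apply_basisVec, Pi.single_apply, Pi.single_apply]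
    simp only [(M.basisVec_injective i).eq_iff]
  · rw [Pi.single_eq_of_ne]
    · by_contra hc
      exact h (M.idx_of_incl hc)
    · rintro rfl
      exact h (M.idx_basisVec i x)

/-- The augmentation. -/
noncomputable def polyAug (I : Ideal (MvPolynomial V K)) :
    (Fin (M.rank 0) → MvPolynomial V K) →ₗ[MvPolynomial V K] (MvPolynomial V K ⧸ I) :=
  (Ideal.Quotient.mkₐ (MvPolynomial V K) I).toLinearMap ∘ₗ LinearMap.proj M.base ∘ₗ M.incl 0

theorem polyAug_apply (p : Fin (M.rank 0) → MvPolynomial V K) :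
    M.polyAug I p = Ideal.Quotient.mk I (M.incl 0 p M.base) := rfl

end SquarefreeResolution

variable [DecidableEq V]

/-- The exponent vector of the product of the variables in `W`. -/
noncomputable def indicatorExp (W : Finset V) : V →₀ ℕ :=
  Finsupp.indicator W fun _ _ => 1

theorem indicatorExp_apply (W : Finset V) (v : V) : indicatorExp W v = if v ∈ W then 1 else 0 := by
  simp [indicatorExp, Finsupp.indicator_apply]

theorem indicatorExp_le_iff {W : Finset V} {α : V →₀ ℕ} : indicatorExp W ≤ α ↔ W ⊆ α.support := by
  rw [Finsupp.le_def]
  refine forall_congr' fun v => ?_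
  rw [indicatorExp_apply, Finsupp.mem_support_iff]
  split_ifs with h
  · simp [h, Nat.one_le_iff_ne_zero]
  · simp [h]

theorem indicatorExp_empty : indicatorExp (∅ : Finset V) = 0 := by
  ext v
  simp [indicatorExp_apply]

theorem support_indicatorExp (W : Finset V) : (indicatorExp W).support = W := by
  ext v
  simp [indicatorExp_apply]

theorem degree_indicatorExp (W : Finset V) : Finsupp.degree (indicatorExp W) = W.card := by
  rw [Finsupp.degree_apply, support_indicatorExp, Finset.card_eq_sum_ones]
  exact Finset.sum_congr rfl fun v hv => by rw [indicatorExp_apply, if_pos hv]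

theorem indicatorExp_add_sdiff {A B : Finset V} (h : A ⊆ B) :
    indicatorExp A + indicatorExp (B \ A) = indicatorExp B := by
  ext v
  simp only [Finsupp.add_apply, indicatorExp_apply, Finset.mem_sdiff]
  have := @h v
  by_cases h1 : v ∈ A <;> by_cases h2 : v ∈ B <;> simp_all

variable {K : Type*} [Field K]

theorem monomial_indicatorExp (W : Finset V) :
    monomial (indicatorExp W) (1 : K) = ∏ v ∈ W, X v := by
  rw [monomial_eq, C_1, one_mul, Finsupp.prod, support_indicatorExp]
  exact Finset.prod_congr rfl fun v hv => by rw [indicatorExp_apply, if_pos hv, pow_one]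

namespace SquarefreeResolution

variable {J : Finset V → Prop} {U : Finset V} (M : SquarefreeResolution K J U)

/-- The matrix of the differential over the polynomial ring. -/
noncomputable def polyMatrix : Matrix M.ι M.ι (MvPolynomial V K) :=
  Matrix.of fun a b => monomial (indicatorExp (M.deg b \ M.deg a)) (M.D a b)

theorem D_ne_zero_of_polyMatrix {a b : M.ι} (h : M.polyMatrix a b ≠ 0) : M.D a b ≠ 0 := by
  intro h0
  exact h (by simp [polyMatrix, h0])

/-- Along `deg a ⊆ deg b ⊆ deg c` the exponents add up to that of `deg c \ deg a`, independently of
`b`, so the identity reduces to `D * D = 0`. -/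
theorem polyMatrix_mul_self : M.polyMatrix * M.polyMatrix = 0 := by
  ext1 a c
  have h : ∀ b, M.polyMatrix a b * M.polyMatrix b c =
      monomial (indicatorExp (M.deg c \ M.deg a)) (M.D a b * M.D b c) := by
    intro b
    simp only [polyMatrix, Matrix.of_apply, monomial_mul]
    by_cases h1 : M.D a b = 0
    · simp [h1]
    by_cases h2 : M.D b c = 0
    · simp [h2]
    congr 2
    have hab := (M.deg_of_ne a b h1).1
    have hbc := (M.deg_of_ne b c h2).1
    have e := indicatorExp_add_sdiff (Finset.sdiff_subset_sdiff hbc (subset_refl (M.deg a)))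
    rw [← e]
    congr 2
    ext v
    have := @hab v
    simp only [Finset.mem_sdiff]
    tauto
  rw [mul_apply, Finset.sum_congr rfl fun b _ => h b, ← map_sum, ← mul_apply, M.sq_zero]
  simp

/-- The strand in multidegree `α` of a vector of polynomials. -/
noncomputable def strand (f : M.ι → MvPolynomial V K) (α : V →₀ ℕ) : M.ι → K :=
  fun a => coeff α (monomial (indicatorExp (M.deg a)) 1 * f a)

/-- Multiplying the `a`-th coordinate by the monomial of `deg a` homogenizes the differential: in
each multidegree the polynomial matrix acts as the scalar matrix. -/
theorem D_mulVec_strand (f : M.ι → MvPolynomial V K) (α : V →₀ ℕ) :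
    M.D *ᵥ M.strand f α = M.strand (M.polyMatrix *ᵥ f) α := by
  funext a
  simp only [mulVec, dotProduct, strand]
  rw [Finset.mul_sum, coeff_sum]
  refine Finset.sum_congr rfl fun b _ => ?_
  by_cases h : M.D a b = 0
  · simp [h, polyMatrix]
  · rw [polyMatrix, Matrix.of_apply, ← mul_assoc, monomial_mul,
      indicatorExp_add_sdiff (M.deg_of_ne a b h).1, one_mul, ← coeff_C_mul, ← mul_assoc,
      C_mul_monomial, mul_one]

theorem deg_subset_of_strand {f : M.ι → MvPolynomial V K} {α : V →₀ ℕ} {a : M.ι}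
    (h : M.strand f α a ≠ 0) : M.deg a ⊆ α.support := by
  rw [strand, coeff_monomial_mul'] at h
  by_contra hc
  exact h (if_neg fun h' => hc (indicatorExp_le_iff.1 h'))

theorem sum_strand (f : M.ι → MvPolynomial V K) (a : M.ι) {A : Finset (V →₀ ℕ)}
    (hA : (monomial (indicatorExp (M.deg a)) 1 * f a).support ⊆ A) :
    ∑ α ∈ A, monomial (α - indicatorExp (M.deg a)) (M.strand f α a) = f a := by
  have hmon : (monomial (indicatorExp (M.deg a)) (1 : K)) ≠ 0 := by simp
  apply mul_left_cancel₀ hmon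
  rw [Finset.mul_sum]
  conv_rhs => rw [MvPolynomial.as_sum (monomial (indicatorExp (M.deg a)) 1 * f a)]
  rw [← Finset.sum_subset hA (fun α _ hα => ?_)]
  · refine Finset.sum_congr rfl fun α hα => ?_
    have h : M.strand f α a ≠ 0 := mem_support_iff.1 hα
    rw [monomial_mul, one_mul,
      add_tsub_cancel_of_le (indicatorExp_le_iff.2 (M.deg_subset_of_strand h))]
    rfl
  · have h : M.strand f α a = 0 := notMem_support_iff.1 hα
    rw [h]
    simp

/-- Exactness is checked strand by strand. The strand in multidegree `α` involves only basis vectors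
with `deg a ⊆ α.support`, so scalar exactness for the set `W = α.support` suffices; the finitely
many scalar solutions are then reassembled into polynomials. -/
theorem polyMatrix_exact (k : ℕ) (f : M.ι → MvPolynomial V K) (hf : ∀ a, f a ≠ 0 → M.idx a = k)
    (hDf : M.polyMatrix *ᵥ f = 0)
    (hk : k = 0 → ∀ m ∈ (f M.base).support, J m.support) :
    ∃ g : M.ι → MvPolynomial V K, (∀ a, g a ≠ 0 → M.idx a = k + 1) ∧ M.polyMatrix *ᵥ g = f := by
  have hidx : ∀ α a, M.strand f α a ≠ 0 → M.idx a = k := fun α a h =>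
    hf a fun h0 => h (by simp [strand, h0])
  have key : ∀ α : V →₀ ℕ, ∃ y : M.ι → K,
      (∀ a, y a ≠ 0 → M.idx a = k + 1 ∧ M.deg a ⊆ α.support) ∧ M.D *ᵥ y = M.strand f α := by
    intro α
    by_cases hz : M.strand f α = 0
    · exact ⟨0, by simp, by rw [hz, mulVec_zero]⟩
    refine M.exact _ k _ (fun a ha => ⟨hidx α a ha, M.deg_subset_of_strand ha⟩) ?_ ?_
    · rw [D_mulVec_strand, hDf]
      funext a
      simp [strand]
    · rintro rfl
      obtain ⟨a, ha⟩ := Function.ne_iff.1 hz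
      obtain rfl := (M.idx_eq_zero a).1 (hidx α a ha)
      refine hk rfl α (mem_support_iff.2 ?_)
      simpa [strand, M.deg_base, indicatorExp_empty] using ha
  choose y hy hy' using key
  let A : Finset (V →₀ ℕ) :=
    Finset.univ.biUnion fun a => (monomial (indicatorExp (M.deg a)) 1 * f a).support
  refine ⟨fun b => ∑ α ∈ A, monomial (α - indicatorExp (M.deg b)) (y α b), fun b hb => ?_, ?_⟩
  · obtain ⟨α, -, hα⟩ := Finset.exists_ne_zero_of_sum_ne_zero hb
    exact (hy α b fun h0 => hα (by simp [h0])).1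
  · funext a
    rw [← M.sum_strand f a (A := A)
      (Finset.subset_biUnion_of_mem (fun a => (monomial (indicatorExp (M.deg a)) 1 * f a).support)
        (Finset.mem_univ a))]
    simp only [mulVec, dotProduct, Finset.mul_sum]
    rw [Finset.sum_comm]
    refine Finset.sum_congr rfl fun α _ => ?_
    rw [← hy' α, mulVec, dotProduct, map_sum]
    refine Finset.sum_congr rfl fun b _ => ?_
    by_cases h1 : M.D a b = 0
    · simp [h1, polyMatrix]
    by_cases h2 : y α b = 0
    · simp [h2]
    rw [polyMatrix, Matrix.of_apply, monomial_mul]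
    congr 2
    have hab := (M.deg_of_ne a b h1).1
    -- The truncated subtractions of exponents are genuine, since `deg a ⊆ deg b ⊆ α.support`.
    have hb := indicatorExp_le_iff.2 (hy α b h2).2
    rw [← indicatorExp_add_sdiff hab] at hb ⊢
    ext v
    have := Finsupp.le_def.1 hb v
    simp only [Finsupp.add_apply, Finsupp.tsub_apply] at this ⊢
    omega

/-- The differential in homological degree `i`. -/
noncomputable def polyDiff (i : ℕ) : (Fin (M.rank (i + 1)) → MvPolynomial V K) →ₗ[MvPolynomial V K]
    (Fin (M.rank i) → MvPolynomial V K) :=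
  M.restr i ∘ₗ M.polyMatrix.mulVecLin ∘ₗ M.incl (i + 1)

theorem incl_polyDiff (i : ℕ) (p : Fin (M.rank (i + 1)) → MvPolynomial V K) :
    M.incl i (M.polyDiff i p) = M.polyMatrix *ᵥ M.incl (i + 1) p := by
  refine M.incl_restr (f := M.polyMatrix *ᵥ M.incl (i + 1) p) fun a ha => ?_
  obtain ⟨b, hb1, hb2⟩ := exists_ne_of_mulVec_ne ha
  have := M.idx_of_ne a b (M.D_ne_zero_of_polyMatrix hb1)
  have := M.idx_of_incl hb2
  omega

theorem polyDiff_single (i : ℕ) (b : Fin (M.rank (i + 1))) (a : Fin (M.rank i)) :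
    M.polyDiff i (Pi.single b 1) a = M.polyMatrix (M.basisVec i a) (M.basisVec (i + 1) b) := by
  simp [polyDiff, incl_single, restr, LinearMap.funLeft_apply]

theorem polyDiff_exact (i : ℕ) : Function.Exact (M.polyDiff (i + 1)) (M.polyDiff i) := by
  intro p
  constructor
  · intro hp
    obtain ⟨g, hg, hg'⟩ := M.polyMatrix_exact (i + 1) (M.incl (i + 1) p)
      (fun a ha => M.idx_of_incl ha) (by rw [← incl_polyDiff, hp, map_zero]) (by omega)
    refine ⟨M.restr (i + 2) g, ?_⟩
    rw [← M.restr_incl _ (M.polyDiff (i + 1) _), incl_polyDiff, M.incl_restr hg, hg', restr_incl]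
  · rintro ⟨q, rfl⟩
    rw [← M.restr_incl _ (M.polyDiff i _), incl_polyDiff, incl_polyDiff, mulVec_mulVec,
      polyMatrix_mul_self, zero_mulVec, map_zero]

variable {I : Ideal (MvPolynomial V K)}

theorem polyAug_exact (hI : ∀ f, f ∈ I ↔ ∀ m ∈ f.support, J m.support) :
    Function.Exact (M.polyDiff 0) (M.polyAug I) := by
  intro p
  rw [polyAug_apply, Ideal.Quotient.eq_zero_iff_mem]
  constructor
  · intro hp
    obtain ⟨g, hg, hg'⟩ := M.polyMatrix_exact 0 (M.incl 0 p) (fun a ha => M.idx_of_incl ha)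
      (by
        funext a
        by_contra hc
        obtain ⟨b, hb1, hb2⟩ := exists_ne_of_mulVec_ne hc
        have := M.idx_of_ne a b (M.D_ne_zero_of_polyMatrix hb1)
        have := M.idx_of_incl hb2
        omega) (fun _ => (hI _).1 hp)
    refine ⟨M.restr 1 g, ?_⟩
    rw [← M.restr_incl _ (M.polyDiff 0 _), incl_polyDiff, M.incl_restr hg, hg', restr_incl]
  · rintro ⟨q, rfl⟩
    rw [incl_polyDiff]
    refine Ideal.sum_mem _ fun b _ => Ideal.mul_mem_right _ _ ((hI _).2 fun m hm => ?_)
    change m ∈ (monomial (indicatorExp (M.deg b \ M.deg M.base)) (M.D M.base b)).support at hm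
    rw [M.deg_base, Finset.sdiff_empty] at hm
    have h0 : M.D M.base b ≠ 0 := by
      intro h0
      simp [h0] at hm
    rw [Finset.mem_singleton.1 (support_monomial_subset hm), support_indicatorExp]
    exact M.mem_of_ne b h0

/-- The minimal graded free resolution over the polynomial ring. -/
noncomputable def toMinimalGradedFreeResolution
    (hI : ∀ f, f ∈ I ↔ ∀ m ∈ f.support, J m.support) : MinimalGradedFreeResolution I where
  rank := M.rank
  shift i x := ((M.deg (M.basisVec i x)).card : ℤ)
  diff := M.polyDiff
  aug := M.polyAug I
  diff_graded i b a := by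
    intro m hm
    rw [polyDiff_single, polyMatrix, Matrix.of_apply] at hm
    have h0 : M.D (M.basisVec i a) (M.basisVec (i + 1) b) ≠ 0 := by
      intro h0
      simp [h0] at hm
    rw [Finset.mem_singleton.1 (support_monomial_subset hm), degree_indicatorExp,
      Finset.cast_card_sdiff (M.deg_of_ne _ _ h0).1]
  aug_graded a := by
    have ha : M.basisVec 0 a = M.base := (M.idx_eq_zero _).1 (M.idx_basisVec 0 a)
    refine ⟨1, ?_, ?_⟩
    · intro m hm
      rw [ha, M.deg_base]
      have : m = 0 := by
        by_contra h
        exact mem_support_iff.1 hm (by rw [coeff_one, if_neg (Ne.symm h)])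
      simp [this]
    · rw [polyAug_apply, incl_single, ha, Pi.single_eq_same]
  minimal i b a := by
    rw [polyDiff_single, polyMatrix, Matrix.of_apply]
    by_cases h0 : M.D (M.basisVec i a) (M.basisVec (i + 1) b) = 0
    · rw [h0, monomial_zero]
      exact Ideal.zero_mem _
    · obtain ⟨v, hv, hv'⟩ := Finset.exists_of_ssubset (M.deg_of_ne _ _ h0)
      rw [← mul_one (M.D _ _), ← C_mul_monomial, monomial_indicatorExp]
      exact Ideal.mul_mem_left _ _ (Ideal.mem_of_dvd _ (Finset.dvd_prod_of_mem _
        (Finset.mem_sdiff.2 ⟨hv, hv'⟩)) (Ideal.subset_span ⟨v, rfl⟩))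
  aug_surjective := by
    intro x
    obtain ⟨f, rfl⟩ := Ideal.Quotient.mk_surjective x
    obtain ⟨a, ha⟩ := M.exists_basisVec ((M.idx_eq_zero M.base).2 rfl)
    refine ⟨fun _ => f, ?_⟩
    rw [polyAug_apply, ← ha, incl_apply_basisVec]
  exact_zero := M.polyAug_exact hI
  exact_succ := M.polyDiff_exact

theorem betti_toMinimalGradedFreeResolution
    (hI : ∀ f, f ∈ I ↔ ∀ m ∈ f.support, J m.support) (i : ℕ) (k : ℤ) :
    ((M.toMinimalGradedFreeResolution hI).betti i k : ℤ) =
      ∑ a, if M.idx a = i ∧ ((M.deg a).card : ℤ) = k then 1 else 0 := by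
  rw [MinimalGradedFreeResolution.betti, Finset.sum_boole, ← Fintype.card_subtype,
    ← Nat.card_eq_fintype_card]
  congr 1
  let e := Fintype.equivFin {a // M.idx a = i}
  exact Nat.card_congr ((e.symm.subtypeEquiv fun x => Iff.rfl).trans
    (Equiv.subtypeSubtypeEquivSubtypeInter (fun a => M.idx a = i)
      fun a => ((M.deg a).card : ℤ) = k))

theorem finite_betti (hI : ∀ f, f ∈ I ↔ ∀ m ∈ f.support, J m.support) (j : ℤ) :
    {i : ℕ | (M.toMinimalGradedFreeResolution hI).betti i (i + j) ≠ 0} ⊆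
      ↑(Finset.univ.image M.idx) := by
  intro i hi
  have h : ((M.toMinimalGradedFreeResolution hI).betti i (i + j) : ℤ) ≠ 0 := by exact_mod_cast hi
  rw [betti_toMinimalGradedFreeResolution] at h
  obtain ⟨a, -, ha⟩ := Finset.exists_ne_zero_of_sum_ne_zero h
  simp only [Finset.coe_image, Finset.coe_univ, Set.image_univ, Set.mem_range]
  exact ⟨a, by by_contra hc; exact ha (if_neg fun h => hc h.1)⟩

/-- `altSum` also counts homological degree zero, where the only basis vector has multidegree `∅`
and contributes `1` to strand `0`; the correction term removes it. -/
theorem finsum_betti (hI : ∀ f, f ∈ I ↔ ∀ m ∈ f.support, J m.support) (j : ℤ) :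
    ∑ᶠ (i : ℕ) (_ : 1 ≤ i), (-1 : ℤ) ^ i *
      ((M.toMinimalGradedFreeResolution hI).betti i (i + j) : ℤ) =
        M.altSum j - if j = 0 then 1 else 0 := by
  have h1 : ∀ i : ℕ, (∑ᶠ (_ : 1 ≤ i), (-1 : ℤ) ^ i *
      ((M.toMinimalGradedFreeResolution hI).betti i (i + j) : ℤ)) =
      ∑ a, if M.idx a = i then
        (if 1 ≤ M.idx a ∧ ((M.deg a).card : ℤ) = M.idx a + j then (-1) ^ M.idx a else 0)
          else 0 := by
    intro i
    rw [finsum_eq_if, betti_toMinimalGradedFreeResolution]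
    by_cases hi : 1 ≤ i
    · rw [if_pos hi, Finset.mul_sum]
      refine Finset.sum_congr rfl fun a _ => ?_
      by_cases ha : M.idx a = i
      · simp [ha, hi]
      · simp [ha]
    · rw [if_neg hi, Finset.sum_eq_zero]
      intro a _
      by_cases ha : M.idx a = i
      · simp [ha, hi]
      · simp [ha]
  rw [finsum_congr h1, finsum_eq_sum_of_support_subset (s := Finset.univ.image M.idx),
    Finset.sum_comm, eq_sub_iff_add_eq, altSum]
  · have h2 : (if j = 0 then 1 else 0 : ℤ) =
        ∑ a, if a = M.base then (if j = 0 then 1 else 0) else 0 := by simp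
    rw [h2, ← Finset.sum_add_distrib]
    refine Finset.sum_congr rfl fun a _ => ?_
    rw [Finset.sum_ite_eq, if_pos (Finset.mem_image_of_mem _ (Finset.mem_univ a))]
    by_cases ha : a = M.base
    · subst ha
      simp [(M.idx_eq_zero M.base).2, M.deg_base, eq_comm]
    · have : 1 ≤ M.idx a := Nat.one_le_iff_ne_zero.2 fun h => ha ((M.idx_eq_zero a).1 h)
      simp [ha, this]
  · intro i hi
    obtain ⟨a, -, ha⟩ := Finset.exists_ne_zero_of_sum_ne_zero hi
    simp only [Finset.coe_image, Finset.coe_univ, Set.image_univ, Set.mem_range]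
    exact ⟨a, by by_contra hc; exact ha (if_neg hc)⟩

end SquarefreeResolution

end Translation

/-! ### Facet sets of trees and their facet ideals -/

section FacetComplexes

variable {V : Type*} {Γ : PreAbstractSimplicialComplex V}

theorem IsFacet.nonempty {F : Finset V} (h : IsFacet Γ F) : F.Nonempty :=
  (Γ.isRelLowerSet_faces h.prop).1

theorem IsFacet.eq_of_subset {F G : Finset V} (hF : IsFacet Γ F) (hG : IsFacet Γ G) (h : F ⊆ G) :
    F = G :=
  Maximal.eq_of_le hF hG.prop h

/-- The complex of all nonempty subsets of members of `T`. -/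
def complexOf (T : Finset (Finset V)) : PreAbstractSimplicialComplex V where
  faces := {G | G.Nonempty ∧ ∃ F ∈ T, G ⊆ F}
  isRelLowerSet_faces := fun _ ⟨hG, F, hF, hGF⟩ =>
    ⟨hG, fun _ hHG hH => ⟨hH, F, hF, le_trans hHG hGF⟩⟩

/-- The members of `T` are facets of one complex, hence pairwise incomparable, so each stays maximal
in the complex they generate. -/
theorem isFacet_complexOf {T : Finset (Finset V)} (hT : ∀ F ∈ T, IsFacet Γ F) {F : Finset V} :
    IsFacet (complexOf T) F ↔ F ∈ T := by
  have hmem : ∀ F ∈ T, F ∈ (complexOf T).faces := fun F hF => ⟨(hT F hF).nonempty, F, hF, subset_rfl⟩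
  constructor
  · intro h
    obtain ⟨-, G, hG, hFG⟩ := h.prop
    exact Maximal.eq_of_le h (hmem G hG) hFG ▸ hG
  · intro hF
    refine ⟨hmem F hF, ?_⟩
    rintro G ⟨-, H, hH, hGH⟩ hFG
    obtain rfl := (hT F hF).eq_of_subset (hT H hH) (le_trans hFG hGH)
    exact hGH

variable [DecidableEq V]

/-- Each subset of the facet set is itself the facet set of a subcomplex, `complexOf T`, to which
the tree condition applies. -/
theorem IsTree.isForest (h : IsTree Γ) {S : Finset (Finset V)} (hS : ∀ F, F ∈ S ↔ IsFacet Γ F) :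
    IsForest S := by
  intro T hTS hT
  have hT' : ∀ F ∈ T, IsFacet Γ F := fun F hF => (hS F).1 (hTS hF)
  have hiff : ∀ F, IsFacet (complexOf T) F ↔ F ∈ T := fun F => isFacet_complexOf hT'
  obtain ⟨F₁, hF₁⟩ := hT
  obtain ⟨F, hF, hF'⟩ := h.2 (complexOf T) (fun F hF => hT' F ((hiff F).1 hF))
    ⟨F₁, ((hiff F₁).2 hF₁).prop⟩
  simp only [hiff] at hF hF'
  exact ⟨F, hF, hF'⟩

theorem IsConnectedInCodimOne.reflTransGen (h : IsConnectedInCodimOne Γ) {S : Finset (Finset V)}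
    (hS : ∀ F, F ∈ S ↔ IsFacet Γ F) {A B : Finset V} (hA : A ∈ S) (hB : B ∈ S)
    (hAB : B.card ≤ A.card) : Relation.ReflTransGen (ProperStep S) A B := by
  obtain ⟨n, c, ⟨rfl, rfl, hc, -⟩, hdim⟩ := h A B ((hS A).1 hA) ((hS B).1 hB) (by
    simpa [faceDim] using hAB)
  have key : ∀ i ≤ n, Relation.ReflTransGen (ProperStep S) (c 0) (c i) := by
    intro i
    induction i with
    | zero => exact fun _ => .refl
    | succ i ih =>
      intro hi
      refine (ih (by omega)).tail ⟨(hS _).2 (hc i (by omega)), (hS _).2 (hc _ hi), ?_⟩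
      have := hdim i (by omega)
      simp only [faceDim] at this
      omega
  exact key n le_rfl

variable {K : Type*} [Field K]

/-- Membership in a monomial ideal is tested monomial by monomial, and divisibility by a squarefree
monomial depends only on the support. -/
theorem mem_facetIdeal_iff {S : Finset (Finset V)} (hS : ∀ F, F ∈ S ↔ IsFacet Γ F)
    (f : MvPolynomial V K) : f ∈ facetIdeal K Γ ↔ ∀ m ∈ f.support, Generates S m.support := by
  have h1 : {f : MvPolynomial V K | ∃ F, IsFacet Γ F ∧ f = ∏ v ∈ F, X v} =
      (fun s => monomial s (1 : K)) '' (indicatorExp '' (S : Set (Finset V))) := by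
    ext f
    simp only [Set.mem_ofPred_eq, Set.mem_image, exists_exists_and_eq_and, monomial_indicatorExp,
      Finset.mem_coe, hS]
    exact exists_congr fun F => and_congr_right fun _ => eq_comm
  rw [facetIdeal, h1, mem_ideal_span_monomial_image]
  simp only [Set.mem_image, exists_exists_and_eq_and, indicatorExp_le_iff, Finset.mem_coe]
  rfl

theorem isLeast_degree_minimalMonomials {S : Finset (Finset V)} (hS : ∀ F, F ∈ S ↔ IsFacet Γ F)
    {F₀ : Finset V} (hF₀ : F₀ ∈ S) (hmin : ∀ A ∈ S, F₀.card ≤ A.card) :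
    IsLeast (Finsupp.degree '' minimalMonomials (facetIdeal K Γ)) F₀.card := by
  have hmon : ∀ n : V →₀ ℕ, monomial n (1 : K) ∈ facetIdeal K Γ ↔ Generates S n.support := by
    intro n
    classical
    rw [mem_facetIdeal_iff hS, support_monomial, if_neg one_ne_zero]
    simp
  constructor
  · refine ⟨indicatorExp F₀, ⟨?_, ?_⟩, degree_indicatorExp F₀⟩
    · exact (hmon _).2 ⟨F₀, hF₀, (support_indicatorExp F₀).ge⟩
    · intro n hn hle
      obtain ⟨H, hH, hHn⟩ := (hmon n).1 hn
      have h1 : n.support ⊆ F₀ := (Finsupp.support_mono hle).trans (support_indicatorExp F₀).le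
      obtain rfl := ((hS H).1 hH).eq_of_subset ((hS F₀).1 hF₀) (hHn.trans h1)
      exact indicatorExp_le_iff.2 hHn
  · rintro _ ⟨m, ⟨hm, -⟩, rfl⟩
    obtain ⟨H, hH, hHm⟩ := (hmon m).1 hm
    refine (hmin H hH).trans ?_
    rw [← degree_indicatorExp]
    exact Finsupp.degree_mono (indicatorExp_le_iff.2 hHm)

/-- The facet ideal of a tree that is connected in codimension one has the alternating sum
property. -/
theorem IsTree.alternatingSumProperty [Fintype V] [Nonempty V] {Δ : AbstractSimplicialComplex V}
    (hTree : IsTree Δ.toPreAbstractSimplicialComplex)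
    (hConn : IsConnectedInCodimOne Δ.toPreAbstractSimplicialComplex) :
    AlternatingSumProperty (facetIdeal K Δ.toPreAbstractSimplicialComplex) := by
  classical
  obtain ⟨S, hS⟩ : ∃ S : Finset (Finset V),
      ∀ F, F ∈ S ↔ IsFacet Δ.toPreAbstractSimplicialComplex F :=
    ⟨Finset.univ.filter fun F => IsFacet Δ.toPreAbstractSimplicialComplex F, by simp⟩
  obtain ⟨v⟩ := ‹Nonempty V›
  have hSne : S.Nonempty := by
    obtain ⟨F, -, hF⟩ := (Set.toFinite Δ.faces).exists_le_maximal (Δ.singleton_mem v)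
    exact ⟨F, (hS F).2 hF⟩
  obtain ⟨F₀, hF₀, hmin⟩ := S.exists_min_image Finset.card hSne
  obtain ⟨M, hM⟩ := (hTree.isForest hS).exists_resolution_altSum K
    (fun h => by simpa using ((hS ∅).1 h).nonempty)
    (fun A hA B hB => ((hS A).1 hA).eq_of_subset ((hS B).1 hB))
    (fun A hA B hB => hConn.reflTransGen hS hA hB) hF₀ hmin
  have hI := mem_facetIdeal_iff (K := K) hS
  refine ⟨⟨M.toMinimalGradedFreeResolution hI⟩, F₀.card,
    isLeast_degree_minimalMonomials hS hF₀ hmin, fun P j _ => ?_⟩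
  -- An arbitrary resolution has the Betti numbers of the constructed one; the facet ideal is
  -- homogeneous because the monomials of a component of `f` are among those of `f`.
  have hbetti : ∀ i k, P.betti i k = (M.toMinimalGradedFreeResolution hI).betti i k :=
    MinimalGradedFreeResolution.betti_eq (fun k f hf => (hI _).2 fun m hm => (hI f).1 hf m (by
      rw [mem_support_iff, coeff_intComponent] at hm
      exact mem_support_iff.2 fun h0 => hm (by simp [h0]))) P _
  simp only [hbetti]
  refine ⟨(Finset.finite_toSet _).subset (M.finite_betti hI j), ?_⟩
  rw [M.finsum_betti hI, hM]
  split_ifs <;> simp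

end FacetComplexes

end FacetIdeal

theorem theorem4p6 {V : Type*} [Fintype V] [DecidableEq V] [Nonempty V] {K : Type*} [Field K]
    (Δ : AbstractSimplicialComplex V)
    (hTree : FacetIdeal.IsTree Δ.toPreAbstractSimplicialComplex)
    (hConn : FacetIdeal.IsConnectedInCodimOne Δ.toPreAbstractSimplicialComplex) :
    FacetIdeal.AlternatingSumProperty
      (FacetIdeal.facetIdeal K Δ.toPreAbstractSimplicialComplex) :=
  hTree.alternatingSumProperty hConn
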